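/- **Theorem 3.6 (Main Theorem, W\*-case).** Let $\Gamma$ be a countable group acting non-singularly and essentially freely on standard probability spaces $(X,\mu)$ and $(Y,\nu)$ (each $s\in\Gamma$ acts measurably and preserves the measure class, and for $s\neq e$ the fixed point set of $s$ is null). Let $\pi\colon (Y,\nu)\to(X,\mu)$ be a factor map, i.e. a measurable map which is $\Gamma$-equivariant up to null sets and for which $\pi_*\nu$ and $\mu$ have the same null sets. Via $f\mapsto f\circ\pi$ regard $L^\infty(X)$ as a $\Gamma$-von Neumann subalgebra of $L^\infty(Y)$, where $\Gamma$ acts on $L^\infty(Y)$ by $(s\cdot f)(y)=f(s^{-1}y)$. An intermediate extension of $\pi$ is a triple consisting of a non-singular action of $\Gamma$ on a standard probability space $(Z,\zeta)$ and factor maps $p\colon Y\to Z$, $q\colon Z\to X$ with $q\circ p=\pi$ almost everywhere; two such triples $(Z,p,q)$, $(Z',p',q')$ are identified if there is a $\Gamma$-isomorphism $h\colon Z\to Z'$ (up to null sets, preserving the measure class) with $h\circ p=p'$ and $q=q'\circ h$ almost everywhere. Via $p$, $L^\infty(Z)$ is regarded as the subalgebra $\{f\circ p: f\in L^\infty(Z)\}$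 of $L^\infty(Y)$. For a $\Gamma$-von Neumann subalgebra $N\subset L^\infty(Y)$ let $N\rtimes\Gamma$ be the von Neumann algebra on $\ell^2(\Gamma,L^2(Y))$ generated by the operators $(f\xi)(t)=(t^{-1}\cdot f)\,\xi(t)$, $f\in N$, and $(u_s\xi)(t)=\xi(s^{-1}t)$, $s\in\Gamma$. Then $Z\mapsto L^\infty(Z)$ is a bijection from the set of equivalence classes of intermediate extensions of $\pi$ onto the set of $\Gamma$-invariant von Neumann algebras $N$ with $L^\infty(X)\subset N\subset L^\infty(Y)$, which is a lattice under $N_1\wedge N_2=N_1\cap N_2$ and $N_1\vee N_2=W^*(N_1,N_2)$; and with the lattice structure so obtained on the intermediate extensions, the map $$L^\infty(Z)\longmapsto L^\infty(Z)\rtimes\Gamma$$ is a lattice isomorphism from the lattice of intermediate extensions of $\pi$ onto the lattice of intermediate von Neumann algebras $Q$, $L^\infty(X)\rtimes\Gamma\subset Q\subset L^\infty(Y)\rtimes\Gamma$, with operations $Q_1\wedge Q_2=Q_1\cap Q_2$ and $Q_1\vee Q_2=W^*(Q_1,Q_2)$. Here $W^*(\cdot,\cdot)$ denotes the generated von Neumann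 algebra. -/

import Mathlib

open MeasureTheory Measure
open scoped ENNReal

universe uΓ uX uY uZ w

noncomputable section

namespace CrossedProductLattice


/-! ### Non-singular actions and factor maps -/

section Actions

variable (Γ : Type uΓ) [Group Γ]

/-- A non-singular action: every group element acts by a measurable map that preserves null sets
(in both directions, since `Γ` is a group). -/
class NonsingularAction {X : Type uX} [MeasurableSpace X] [MulAction Γ X] (μ : Measure X) :
    Prop where
  quasi : ∀ s : Γ, QuasiMeasurePreserving (fun x : X => s • x) μ μ

/-- Essential freeness: every nontrivial group element has a null set of fixed points. -/
def EssentiallyFree {X : Type uX} [MeasurableSpace X] [MulAction Γ X] (μ : Measure X) : Prop :=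
  ∀ s : Γ, s ≠ 1 → μ {x : X | s • x = x} = 0

/-- A factor map `(Y, ν) → (Z, ζ)`: a measurable map, equivariant up to null sets, such that the
push-forward of `ν` has the same null sets as `ζ`. -/
structure IsFactorMap {Y : Type uY} {Z : Type uZ} [MeasurableSpace Y] [MeasurableSpace Z]
    [MulAction Γ Y] [MulAction Γ Z] (ν : Measure Y) (ζ : Measure Z) (p : Y → Z) : Prop where
  quasi : QuasiMeasurePreserving p ν ζ
  absolutelyContinuous : ζ ≪ ν.map p
  equivariant : ∀ s : Γ, ∀ᵐ y ∂ν, p (s • y) = s • p y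

variable {Γ}

theorem IsFactorMap.ae_comp {Y : Type uY} {Z : Type uZ} [MeasurableSpace Y] [MeasurableSpace Z]
    [MulAction Γ Y] [MulAction Γ Z] {ν : Measure Y} {ζ : Measure Z} {p : Y → Z}
    (hp : IsFactorMap Γ ν ζ p) {P : Z → Prop} (h : ∀ᵐ z ∂ζ, P z) : ∀ᵐ y ∂ν, P (p y) :=
  hp.quasi.ae h

theorem IsFactorMap.comp {X : Type uX} {Y : Type uY} {Z : Type uZ} [MeasurableSpace X]
    [MeasurableSpace Y] [MeasurableSpace Z] [MulAction Γ X] [MulAction Γ Y] [MulAction Γ Z]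
    {ν : Measure Y} {ζ : Measure Z} {μ : Measure X} {p : Y → Z} {q : Z → X}
    (hq : IsFactorMap Γ ζ μ q) (hp : IsFactorMap Γ ν ζ p) : IsFactorMap Γ ν μ (q ∘ p) where
  quasi := hq.quasi.comp hp.quasi
  absolutelyContinuous := by
    rw [← Measure.map_map hq.quasi.measurable hp.quasi.measurable]
    exact hq.absolutelyContinuous.trans (hp.absolutelyContinuous.map hq.quasi.measurable)
  equivariant s := by
    filter_upwards [hp.equivariant s, hp.ae_comp (hq.equivariant s)] with y h₁ h₂
    simp only [Function.comp_apply, h₁, h₂]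

theorem IsFactorMap.id {Y : Type uY} [MeasurableSpace Y] [MulAction Γ Y] (ν : Measure Y) :
    IsFactorMap Γ ν ν (_root_.id : Y → Y) where
  quasi := .id ν
  absolutelyContinuous := by rw [Measure.map_id]
  equivariant _ := Filter.Eventually.of_forall fun _ => rfl

end Actions

/-! ### The algebra `L^∞` -/

section Linfty

variable {Y : Type uY} {Z : Type uZ} [MeasurableSpace Y] [MeasurableSpace Z]
  {ν : Measure Y} {ζ : Measure Z}

theorem ae_norm_comp_le {p : Y → Z} (hp : QuasiMeasurePreserving p ν ζ) (f : Lp ℂ ∞ ζ) :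
    ∀ᵐ y ∂ν, ‖(f ∘ p) y‖ ≤ ‖f‖ := by
  refine hp.ae (p := fun z => ‖f z‖ ≤ ‖f‖) ?_
  filter_upwards [ae_le_eLpNormEssSup (f := f) (μ := ζ)] with z hz
  rw [← eLpNorm_exponent_top] at hz
  rw [Lp.norm_def, ← toReal_enorm]
  exact ENNReal.toReal_mono (Lp.eLpNorm_ne_top f) hz

theorem memLp_comp {p : Y → Z} (hp : QuasiMeasurePreserving p ν ζ) (f : Lp ℂ ∞ ζ) :
    MemLp (f ∘ p) ∞ ν :=
  memLp_top_of_bound ((Lp.aestronglyMeasurable f).comp_quasiMeasurePreserving hp) ‖f‖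
    (ae_norm_comp_le hp f)

/-- The *-homomorphism `L^∞(Z) → L^∞(Y)`, `f ↦ f ∘ p`. -/
def pullback (p : Y → Z) (hp : QuasiMeasurePreserving p ν ζ) (f : Lp ℂ ∞ ζ) : Lp ℂ ∞ ν :=
  (memLp_comp hp f).toLp (f ∘ p)

theorem norm_pullback_le (p : Y → Z) (hp : QuasiMeasurePreserving p ν ζ) (f : Lp ℂ ∞ ζ) :
    ‖pullback p hp f‖ ≤ ‖f‖ := by
  rw [pullback, Lp.norm_toLp, eLpNorm_exponent_top]
  exact ENNReal.toReal_le_of_le_ofReal (norm_nonneg _)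
    (eLpNormEssSup_le_of_ae_bound (ae_norm_comp_le hp f))

/-- The representation of `L^∞(Y)` on `L²(Y)` by multiplication operators. -/
def mulOp (f : Lp ℂ ∞ ν) : Lp ℂ 2 ν →L[ℂ] Lp ℂ 2 ν :=
  (ContinuousLinearMap.mul ℂ ℂ).holderL ν ∞ 2 2 f

theorem norm_mulOp_le (f : Lp ℂ ∞ ν) : ‖mulOp f‖ ≤ ‖f‖ := by
  refine ContinuousLinearMap.opNorm_le_bound _ (norm_nonneg _) fun g => ?_
  refine ((ContinuousLinearMap.mul ℂ ℂ).norm_holder_apply_apply_le f g).trans ?_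
  gcongr
  exact mul_le_of_le_one_left (norm_nonneg _) (ContinuousLinearMap.opNorm_mul_le ℂ ℂ)

/-- The action of `Γ` on `L^∞(Y)`: `s` maps `f` to `y ↦ f (s⁻¹ y)`. -/
def translate {Γ : Type uΓ} [Group Γ] [MulAction Γ Y] [NonsingularAction Γ ν] (s : Γ)
    (f : Lp ℂ ∞ ν) : Lp ℂ ∞ ν :=
  pullback (fun y : Y => s⁻¹ • y) (NonsingularAction.quasi s⁻¹) f

end Linfty

/-! ### Von Neumann algebras -/

/-- The von Neumann algebra generated by a set `S` of bounded operators: the bicommutant of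
`S ∪ S*`. -/
def generated {H : Type*} [NormedAddCommGroup H] [InnerProductSpace ℂ H] [CompleteSpace H]
    (S : Set (H →L[ℂ] H)) : VonNeumannAlgebra H where
  toStarSubalgebra :=
    StarSubalgebra.centralizer ℂ (StarSubalgebra.centralizer ℂ S : Set (H →L[ℂ] H))
  centralizer_centralizer' := by simp

/-! ### The crossed product, in the left regular representation on `ℓ²(Γ, L²(Y))` -/

section Crossed

/-- The Hilbert space `L²(Y) ⊗ ℓ²(Γ) = ℓ²(Γ, L²(Y))`. -/
abbrev RegularSpace (Γ : Type uΓ) {Y : Type uY} [MeasurableSpace Y] (ν : Measure Y) :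
    Type (max uΓ uY) :=
  lp (fun _ : Γ => Lp ℂ 2 ν) 2

theorem memℓp_diag {ι H : Type*} [NormedAddCommGroup H] [NormedSpace ℂ H]
    (T : ι → H →L[ℂ] H) (C : ℝ) (hT : ∀ i, ‖T i‖ ≤ C) (ξ : lp (fun _ : ι => H) 2) :
    Memℓp (fun i => T i (ξ i)) 2 := by
  refine ((lp.memℓp ξ).const_smul (C : ℂ)).mono' fun i => ?_
  rw [Pi.smul_apply, norm_smul, Complex.norm_real]
  exact ((T i).le_opNorm _).trans
    (mul_le_mul_of_nonneg_right ((hT i).trans (le_abs_self C)) (norm_nonneg _))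

/-- The diagonal operator `(ξ i)ᵢ ↦ (T i (ξ i))ᵢ` on `ℓ²(ι, H)` for a bounded family `T`. -/
def diagOp {ι H : Type*} [NormedAddCommGroup H] [NormedSpace ℂ H]
    (T : ι → H →L[ℂ] H) (C : ℝ) (hT : ∀ i, ‖T i‖ ≤ C) :
    lp (fun _ : ι => H) 2 →L[ℂ] lp (fun _ : ι => H) 2 :=
  LinearMap.mkContinuous
    { toFun := fun ξ => ⟨fun i => T i (ξ i), memℓp_diag T C hT ξ⟩
      map_add' := fun ξ η => by ext i : 2; exact map_add (T i) (ξ i) (η i)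
      map_smul' := fun c ξ => by ext i : 2; exact map_smul (T i) c (ξ i) }
    |C| fun ξ => by
      have h : ‖(⟨fun i => T i (ξ i), memℓp_diag T C hT ξ⟩ : lp (fun _ : ι => H) 2)‖ ≤
          ‖(C : ℂ) • ξ‖ := by
        refine lp.norm_mono (by norm_num) fun i => ?_
        rw [lp.coeFn_smul, Pi.smul_apply, norm_smul, Complex.norm_real]
        exact ((T i).le_opNorm _).trans
          (mul_le_mul_of_nonneg_right ((hT i).trans (le_abs_self C)) (norm_nonneg _))
      rwa [norm_smul, Complex.norm_real] at h

theorem memℓp_reindex {ι H : Type*} [NormedAddCommGroup H] (e : ι ≃ ι)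
    (ξ : lp (fun _ : ι => H) 2) : Memℓp (fun i => ξ (e i)) 2 := by
  refine memℓp_gen ?_
  exact e.summable_iff.mpr ((lp.memℓp ξ).summable (by norm_num))

/-- The operator `(ξ i)ᵢ ↦ (ξ (e i))ᵢ` on `ℓ²(ι, H)` for a permutation `e`. -/
def reindexOp {ι H : Type*} [NormedAddCommGroup H] [NormedSpace ℂ H] (e : ι ≃ ι) :
    lp (fun _ : ι => H) 2 →L[ℂ] lp (fun _ : ι => H) 2 :=
  LinearMap.mkContinuous
    { toFun := fun ξ => ⟨fun i => ξ (e i), memℓp_reindex e ξ⟩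
      map_add' := fun _ _ => rfl
      map_smul' := fun _ _ => rfl }
    1 fun ξ => by
      rw [one_mul]
      refine le_of_eq ?_
      rw [lp.norm_eq_tsum_rpow (by norm_num), lp.norm_eq_tsum_rpow (by norm_num)]
      congr 1
      exact e.tsum_eq fun i => ‖ξ i‖ ^ (2 : ℝ≥0∞).toReal

variable (Γ : Type uΓ) [Group Γ] {Y : Type uY} [MeasurableSpace Y] {ν : Measure Y}

/-- The left regular representation of `f ∈ L^∞(Y)`: the `t`-th coordinate of a vector is
multiplied by the translate of `f` under `t⁻¹`. -/
def coeffOp [MulAction Γ Y] [NonsingularAction Γ ν] (f : Lp ℂ ∞ ν) :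
    RegularSpace Γ ν →L[ℂ] RegularSpace Γ ν :=
  diagOp (fun t : Γ => mulOp (translate t⁻¹ f)) ‖f‖ fun _ =>
    (norm_mulOp_le _).trans (norm_pullback_le _ _ f)

variable {Γ} (ν) in
/-- The implementing unitary `u_s`, with `(u_s ξ)(t) = ξ (s⁻¹ t)`. -/
def groupOp (s : Γ) : RegularSpace Γ ν →L[ℂ] RegularSpace Γ ν :=
  reindexOp (Equiv.mulLeft s⁻¹)

/-- The crossed product `N ⋊ Γ` for a `Γ`-von Neumann subalgebra `N` of `L^∞(Y)`: the von Neumann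
algebra on `ℓ²(Γ, L²(Y))` generated by the copy of `N` and the unitaries `u_s`. -/
def crossedProduct [MulAction Γ Y] [NonsingularAction Γ ν] (N : Set (Lp ℂ ∞ ν)) :
    VonNeumannAlgebra (RegularSpace Γ ν) :=
  generated (coeffOp Γ '' N ∪ Set.range (groupOp (Γ := Γ) ν))

end Crossed

/-! ### Intermediate `Γ`-von Neumann algebras and intermediate extensions -/

section Intermediate

variable (Γ : Type uΓ) [Group Γ] {X : Type uX} {Y : Type uY}
  [MeasurableSpace X] [MeasurableSpace Y] [MulAction Γ X] [MulAction Γ Y]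
  (μ : Measure X) (ν : Measure Y)

/-- An intermediate `Γ`-von Neumann algebra `N` of `L^∞(X) ⊂ L^∞(Y)`, where `L^∞(X)` sits in
`L^∞(Y)` through `π`. -/
@[ext]
structure IntermediateAlgebra [NonsingularAction Γ ν] (π : Y → X)
    (hπ : QuasiMeasurePreserving π ν μ) where
  carrier : Set (Lp ℂ ∞ ν)
  isVonNeumann : ∃ A : VonNeumannAlgebra (Lp ℂ 2 ν), (A : Set _) = mulOp '' carrier
  translate_mem : ∀ (s : Γ), ∀ f ∈ carrier, translate s f ∈ carrier
  base_mem : Set.range (pullback π hπ) ⊆ carrier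

/-- Intermediate algebras are ordered by inclusion. -/
instance [NonsingularAction Γ ν] (π : Y → X) (hπ : QuasiMeasurePreserving π ν μ) :
    PartialOrder (IntermediateAlgebra Γ μ ν π hπ) :=
  PartialOrder.lift IntermediateAlgebra.carrier fun _ _ h => IntermediateAlgebra.ext h

/-- An intermediate extension of `π : (Y, ν) → (X, μ)`: a non-singular action of `Γ` on a standard
probability space `(Z, ζ)` with factor maps `p : Y → Z` and `q : Z → X` such that `q ∘ p = π`
up to null sets. -/
structure IntermediateExtension (π : Y → X) where
  Z : Type w
  [measurableSpace : MeasurableSpace Z]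
  [standardBorel : StandardBorelSpace Z]
  ζ : Measure Z
  [isProbabilityMeasure : IsProbabilityMeasure ζ]
  [mulAction : MulAction Γ Z]
  [nonsingular : NonsingularAction Γ ζ]
  p : Y → Z
  q : Z → X
  isFactorMap_p : IsFactorMap Γ ν ζ p
  isFactorMap_q : IsFactorMap Γ ζ μ q
  comp_eq : q ∘ p =ᵐ[ν] π

attribute [instance] IntermediateExtension.measurableSpace IntermediateExtension.standardBorel
  IntermediateExtension.isProbabilityMeasure IntermediateExtension.mulAction
  IntermediateExtension.nonsingular

variable {Γ μ ν}

namespace IntermediateExtension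

variable {π : Y → X}

/-- The algebra `L^∞(Z)`, regarded as a subalgebra of `L^∞(Y)` through `p`. -/
def linfty (E : IntermediateExtension.{uΓ, uX, uY, w} Γ μ ν π) : Set (Lp ℂ ∞ ν) :=
  Set.range (pullback E.p E.isFactorMap_p.quasi)

/-- Two intermediate extensions are equivalent if there is a `Γ`-isomorphism `h : Z → Z'` of
measure spaces up to null sets (with inverse `k`) such that `h ∘ p = p'` and `q = q' ∘ h`. -/
def Equivalent (E E' : IntermediateExtension.{uΓ, uX, uY, w} Γ μ ν π) : Prop :=
  ∃ (h : E.Z → E'.Z) (k : E'.Z → E.Z),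
    IsFactorMap Γ E.ζ E'.ζ h ∧ IsFactorMap Γ E'.ζ E.ζ k ∧
    (∀ᵐ z ∂E.ζ, k (h z) = z) ∧ (∀ᵐ z ∂E'.ζ, h (k z) = z) ∧
    (∀ᵐ y ∂ν, h (E.p y) = E'.p y) ∧ (∀ᵐ z ∂E.ζ, E.q z = E'.q (h z))

theorem equivalence_equivalent :
    Equivalence (Equivalent (Γ := Γ) (μ := μ) (ν := ν) (π := π)) where
  refl E := ⟨id, id, .id _, .id _, .of_forall fun _ => rfl, .of_forall fun _ => rfl,
    .of_forall fun _ => rfl, .of_forall fun _ => rfl⟩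
  symm := by
    rintro E E' ⟨h, k, hh, hk, hkh, hhk, hp, hq⟩
    refine ⟨k, h, hk, hh, hhk, hkh, ?_, ?_⟩
    · filter_upwards [hp, E.isFactorMap_p.ae_comp hkh] with y h₁ h₂
      rw [← h₁, h₂]
    · filter_upwards [hhk, hk.ae_comp hq] with z h₁ h₂
      rw [h₂, h₁]
  trans := by
    rintro E E' E'' ⟨h, k, hh, hk, hkh, hhk, hp, hq⟩ ⟨h', k', hh', hk', hkh', hhk', hp', hq'⟩
    refine ⟨h' ∘ h, k ∘ k', hh'.comp hh, hk.comp hk', ?_, ?_, ?_, ?_⟩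
    · filter_upwards [hkh, hh.ae_comp hkh'] with z h₁ h₂
      simp only [Function.comp_apply, h₂, h₁]
    · filter_upwards [hhk', hk'.ae_comp hhk] with z h₁ h₂
      simp only [Function.comp_apply, h₂, h₁]
    · filter_upwards [hp, hp'] with y h₁ h₂
      simp only [Function.comp_apply, h₁, h₂]
    · filter_upwards [hq, hh.ae_comp hq'] with z h₁ h₂
      simp only [Function.comp_apply, h₁, h₂]

end IntermediateExtension

variable (Γ μ ν) in
/-- Equivalence of intermediate extensions as a setoid. -/
instance extensionSetoid (π : Y → X) :
    Setoid (IntermediateExtension.{uΓ, uX, uY, w} Γ μ ν π) :=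
  ⟨IntermediateExtension.Equivalent, IntermediateExtension.equivalence_equivalent⟩

variable (Γ μ ν) in
/-- Equivalence classes of intermediate extensions of `π`. -/
abbrev ExtensionClass (π : Y → X) :=
  Quotient (extensionSetoid.{uΓ, uX, uY, w} Γ μ ν π)

end Intermediate

end CrossedProductLattice

end

open CrossedProductLattice

/-!
The crossed product `N ⋊ Γ` is described by Fourier coefficients: `x` lies in it if and only if
there are `c g ∈ N` such that the matrix of `x` has the entries `x s t = s⁻¹ • c (s t⁻¹)`. Here one
inclusion tests `x` against the commutant, which contains `N'` acting diagonally and the right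
translations twisted by the Koopman representation.

Let `L^∞(X) ⋊ Γ ⊆ Q ⊆ L^∞(Y) ⋊ Γ`. As `Γ` acts essentially freely on `X`, countably many
functions `u : X → {1, -1}` separate `s • x` from `t • x` for `s ≠ t`. Each pinching
`x ↦ (x + u x u) / 2` preserves `Q`, fixes the diagonal entries and deletes an entry `x s t` on the
set where `s • u` and `t • u` differ, so the successive pinchings of `x ∈ Q` converge strongly to
the diagonal of `x`. Applied to `x u_g⁻¹`, this puts all Fourier coefficients of `x` into `Q`, and
therefore `Q = N ⋊ Γ` with `N = Q ∩ L^∞(Y)`.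

An intermediate algebra `N` is `L^∞` of an invariant sub-σ-algebra. If `w` is a function into a
standard Borel space `W` that generates this σ-algebra up to null sets, the coding map
`y ↦ (w (s⁻¹ • y))ₛ` into `W^Γ` is an equivariant map whose image measure realizes `N`.
-/

noncomputable section

namespace CrossedProductLattice

open Filter Topology

/-! ### Multiplication operators -/

section Linfty

variable {Y : Type uY} [MeasurableSpace Y] {ν : Measure Y}

theorem ae_norm_le_norm (f : Lp ℂ ∞ ν) : ∀ᵐ y ∂ν, ‖f y‖ ≤ ‖f‖ :=
  ae_norm_comp_le (QuasiMeasurePreserving.id ν) f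

theorem norm_le_of_ae_norm_le {f : Lp ℂ ∞ ν} {C : ℝ} (hC : 0 ≤ C) (h : ∀ᵐ y ∂ν, ‖f y‖ ≤ C) :
    ‖f‖ ≤ C := by
  rw [Lp.norm_def, eLpNorm_exponent_top]
  exact ENNReal.toReal_le_of_le_ofReal hC (eLpNormEssSup_le_of_ae_bound h)

theorem exists_linfty_ae_eq {h : Y → ℂ} (hm : AEStronglyMeasurable h ν) {C : ℝ}
    (hb : ∀ᵐ y ∂ν, ‖h y‖ ≤ C) : ∃ f : Lp ℂ ∞ ν, f =ᵐ[ν] h :=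
  ⟨(memLp_top_of_bound hm C hb).toLp h, MemLp.coeFn_toLp _⟩

/-- The indicator function of a measurable set as an element of `L^∞`; unlike for
`indicatorConstLp`, the set may have infinite measure. -/
def setIndicator {s : Set Y} (hs : MeasurableSet s) : Lp ℂ ∞ ν :=
  ((memLp_top_const (1 : ℂ)).indicator hs).toLp _

theorem coeFn_setIndicator {s : Set Y} (hs : MeasurableSet s) :
    (setIndicator hs : Lp ℂ ∞ ν) =ᵐ[ν] s.indicator fun _ => 1 :=
  MemLp.coeFn_toLp _

theorem coeFn_mulOp (f : Lp ℂ ∞ ν) (ξ : Lp ℂ 2 ν) : mulOp f ξ =ᵐ[ν] fun y => f y * ξ y :=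
  (ContinuousLinearMap.mul ℂ ℂ).coeFn_holder f ξ

theorem mulOp_apply_eq {f : Lp ℂ ∞ ν} {ξ η : Lp ℂ 2 ν} (h : η =ᵐ[ν] fun y => f y * ξ y) :
    mulOp f ξ = η :=
  Lp.ext ((coeFn_mulOp f ξ).trans h.symm)

theorem mulOp_add (f g : Lp ℂ ∞ ν) : mulOp (f + g) = mulOp f + mulOp g :=
  map_add _ f g

theorem mulOp_smul (c : ℂ) (f : Lp ℂ ∞ ν) : mulOp (c • f) = c • mulOp f :=
  map_smul _ c f

theorem mulOp_mul (f g : Lp ℂ ∞ ν) : mulOp (f • g : Lp ℂ ∞ ν) = mulOp f * mulOp g := by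
  ext1 ξ
  refine mulOp_apply_eq ?_
  filter_upwards [Lp.coeFn_lpSMul (r := ∞) f g, coeFn_mulOp g ξ, coeFn_mulOp f (mulOp g ξ)]
    with y hfg hg hf
  rw [mul_apply_eq_comp, hf, hg, hfg, Pi.smul_apply', smul_eq_mul, mul_assoc]

theorem lpSMul_comm (f g : Lp ℂ ∞ ν) : (f • g : Lp ℂ ∞ ν) = (g • f : Lp ℂ ∞ ν) := by
  refine Lp.ext ?_
  filter_upwards [Lp.coeFn_lpSMul (r := ∞) f g, Lp.coeFn_lpSMul (r := ∞) g f] with y hfg hgf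
  rw [hfg, hgf, Pi.smul_apply', Pi.smul_apply', smul_eq_mul, smul_eq_mul, mul_comm]

theorem commute_mulOp (f g : Lp ℂ ∞ ν) : Commute (mulOp f) (mulOp g) := by
  rw [commute_iff_eq, ← mulOp_mul, ← mulOp_mul, lpSMul_comm]

theorem mulOp_star (f : Lp ℂ ∞ ν) : mulOp (star f) = star (mulOp f) := by
  rw [ContinuousLinearMap.star_eq_adjoint, ContinuousLinearMap.eq_adjoint_iff]
  intro ξ η
  rw [L2.inner_def, L2.inner_def]
  refine integral_congr_ae ?_
  filter_upwards [Lp.coeFn_star f, coeFn_mulOp (star f) ξ, coeFn_mulOp f η] with y hstar hξ hη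
  rw [hξ, hη, hstar, Pi.star_apply]
  simp only [RCLike.inner_apply, map_mul, RCLike.star_def, Complex.conj_conj]
  ring

theorem tendsto_Lp_of_dominated {E : Type*} [NormedAddCommGroup E] {p : ℝ≥0∞} [Fact (1 ≤ p)]
    (hp : p ≠ ∞) {F : ℕ → Lp E p ν} {f : Lp E p ν} {b : Y → ℝ} (hb : MemLp b p ν)
    (hF : ∀ n, ∀ᵐ y ∂ν, ‖F n y‖ ≤ b y)
    (hlim : ∀ᵐ y ∂ν, Tendsto (fun n => F n y) atTop (𝓝 (f y))) : Tendsto F atTop (𝓝 f) := by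
  have hp₀ : p ≠ 0 := (zero_lt_one.trans_le Fact.out).ne'
  have hpos : 0 < p.toReal := ENNReal.toReal_pos hp₀ hp
  rw [Lp.tendsto_Lp_iff_tendsto_eLpNorm']
  have hF' : ∀ᵐ y ∂ν, ∀ n, ‖F n y‖ ≤ b y := ae_all_iff.2 hF
  have hlintegral : Tendsto (fun n => ∫⁻ y, ‖(⇑(F n) - ⇑f) y‖ₑ ^ p.toReal ∂ν) atTop
      (𝓝 (∫⁻ _, 0 ∂ν)) := by
    refine tendsto_lintegral_of_dominated_convergence' (fun y => ‖(b + b) y‖ₑ ^ p.toReal)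
      (fun n => ((Lp.aestronglyMeasurable _).sub (Lp.aestronglyMeasurable _)).enorm.pow_const _)
      (fun n => ?_)
      (lintegral_rpow_enorm_lt_top_of_eLpNorm_lt_top hp₀ hp (hb.add hb).eLpNorm_lt_top).ne ?_
    · filter_upwards [hF', hlim] with y hy hy_lim
      have hf : ‖f y‖ ≤ b y := le_of_tendsto hy_lim.norm (.of_forall hy)
      gcongr
      exact enorm_le_iff_norm_le.2
        ((norm_sub_le _ _).trans ((add_le_add (hy n) hf).trans (le_abs_self (b y + b y))))
    · filter_upwards [hlim] with y hy
      have h := (hy.sub_const (f y)).enorm.ennrpow_const p.toReal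
      rwa [sub_self, enorm_zero, ENNReal.zero_rpow_of_pos hpos] at h
  have h := hlintegral.ennrpow_const (1 / p.toReal)
  rw [lintegral_zero, ENNReal.zero_rpow_of_pos (by positivity)] at h
  simpa only [eLpNorm_eq_lintegral_rpow_enorm_toReal hp₀ hp] using h

/-- Bounded almost everywhere convergence of a sequence in `L^∞`. On bounded sets it plays the
role of convergence in the strong operator topology. -/
structure BoundedAETendsto (F : ℕ → Lp ℂ ∞ ν) (f : Lp ℂ ∞ ν) : Prop where
  exists_norm_le : ∃ C, ∀ n, ‖F n‖ ≤ C
  ae_tendsto : ∀ᵐ y ∂ν, Tendsto (fun n => F n y) atTop (𝓝 (f y))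

theorem BoundedAETendsto.tendsto_mulOp {F : ℕ → Lp ℂ ∞ ν} {f : Lp ℂ ∞ ν}
    (h : BoundedAETendsto F f) (ξ : Lp ℂ 2 ν) :
    Tendsto (fun n => mulOp (F n) ξ) atTop (𝓝 (mulOp f ξ)) := by
  obtain ⟨C, hC⟩ := h.exists_norm_le
  refine tendsto_Lp_of_dominated ENNReal.ofNat_ne_top ((Lp.memLp ξ).norm.const_mul C)
    (fun n => ?_) ?_
  · filter_upwards [coeFn_mulOp (F n) ξ, ae_norm_le_norm (F n)] with y hy hFy
    rw [hy, norm_mul]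
    gcongr
    exact hFy.trans (hC n)
  · filter_upwards [h.ae_tendsto, coeFn_mulOp f ξ, ae_all_iff.2 fun n => coeFn_mulOp (F n) ξ]
      with y hlim hf hF
    simp only [hf, hF]
    exact hlim.mul_const _

theorem enorm_mulOp_setIndicator_sq {s : Set Y} (hs : MeasurableSet s) (ξ : Lp ℂ 2 ν) :
    ‖mulOp (setIndicator hs) ξ‖ₑ ^ 2 = ∫⁻ y in s, ‖ξ y‖ₑ ^ 2 ∂ν := by
  have hξ : mulOp (setIndicator hs) ξ =ᵐ[ν] s.indicator ξ := by
    filter_upwards [coeFn_mulOp (setIndicator hs) ξ, coeFn_setIndicator (ν := ν) hs] with y hy hsy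
    rw [hy, hsy]
    by_cases hys : y ∈ s <;> simp [hys]
  have hpow := eLpNorm_nnreal_pow_eq_lintegral (f := ξ) (μ := ν.restrict s) (two_ne_zero' NNReal)
  rw [Lp.enorm_def, eLpNorm_congr_ae hξ, eLpNorm_indicator_eq_eLpNorm_restrict hs]
  simpa using hpow

section MaximalAbelian

variable [IsFiniteMeasure ν]

variable (ν) in
/-- The constant function `1` in `L²`, the cyclic and separating vector of `L^∞`. -/
abbrev oneL2 : Lp ℂ 2 ν :=
  Lp.const 2 ν 1

theorem coeFn_mulOp_one (f : Lp ℂ ∞ ν) : mulOp f (oneL2 ν) =ᵐ[ν] f := by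
  filter_upwards [coeFn_mulOp f (oneL2 ν), Lp.coeFn_const 2 ν (1 : ℂ)] with y hy h1
  rw [hy, h1, Function.const_apply, mul_one]

theorem mulOp_injective : Function.Injective (mulOp : Lp ℂ ∞ ν → Lp ℂ 2 ν →L[ℂ] Lp ℂ 2 ν) :=
  fun f g h => Lp.ext ((coeFn_mulOp_one f).symm.trans (h ▸ coeFn_mulOp_one g))

theorem mulOp_const (c : ℂ) : mulOp (Lp.const ∞ ν c) = c • 1 := by
  ext1 ξ
  refine mulOp_apply_eq ?_
  filter_upwards [Lp.coeFn_const ∞ ν c, Lp.coeFn_smul c ξ] with y hc hξ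
  rw [hc]
  exact hξ

theorem denseRange_mulOp_one : DenseRange fun f : Lp ℂ ∞ ν => mulOp f (oneL2 ν) := by
  refine (Lp.simpleFunc.denseRange (E := ℂ) (p := 2) (μ := ν) ENNReal.ofNat_ne_top).mono ?_
  rintro _ ⟨s, rfl⟩
  refine ⟨((Lp.simpleFunc.toSimpleFunc s).memLp_top ν).toLp _,
    Lp.ext ((coeFn_mulOp_one _).trans ?_)⟩
  exact (MemLp.coeFn_toLp _).trans (Lp.simpleFunc.toSimpleFunc_eq_toFun s)

variable {T : Lp ℂ 2 ν →L[ℂ] Lp ℂ 2 ν}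

theorem ae_norm_apply_one_le_of_commute (hT : ∀ f : Lp ℂ ∞ ν, Commute T (mulOp f)) :
    ∀ᵐ y ∂ν, ‖T (oneL2 ν) y‖ ≤ ‖T‖ := by
  have hsq : (fun y => ‖T (oneL2 ν) y‖ₑ ^ 2) ≤ᵐ[ν] fun y => ‖T‖ₑ ^ 2 * ‖oneL2 ν y‖ₑ ^ 2 := by
    refine ae_le_of_forall_setLIntegral_le_of_sigmaFinite₀
      ((Lp.aestronglyMeasurable _).enorm.pow_const 2) fun s hs _ => ?_
    rw [lintegral_const_mul' _ _ (by simp), ← enorm_mulOp_setIndicator_sq hs,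
      ← enorm_mulOp_setIndicator_sq hs, ← mul_pow, ← mul_apply_eq_comp, ← hT, mul_apply_eq_comp]
    gcongr
    exact T.le_opENorm _
  filter_upwards [hsq, Lp.coeFn_const 2 ν (1 : ℂ)] with y hy h1
  rw [h1, Function.const_apply, enorm_one, one_pow, mul_one] at hy
  exact enorm_le_iff_norm_le.1 (((ENNReal.pow_le_pow_left_iff two_ne_zero).1 hy))

theorem exists_mulOp_eq_of_commute (hT : ∀ f : Lp ℂ ∞ ν, Commute T (mulOp f)) :
    ∃ g : Lp ℂ ∞ ν, mulOp g = T := by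
  obtain ⟨g, hg⟩ := exists_linfty_ae_eq (Lp.aestronglyMeasurable (T (oneL2 ν)))
    (ae_norm_apply_one_le_of_commute hT)
  have hg1 : mulOp g (oneL2 ν) = T (oneL2 ν) := Lp.ext ((coeFn_mulOp_one g).trans hg)
  refine ⟨g, DFunLike.coe_injective
    (denseRange_mulOp_one.equalizer (mulOp g).continuous T.continuous (funext fun f => ?_))⟩
  calc mulOp g (mulOp f (oneL2 ν)) = mulOp f (mulOp g (oneL2 ν)) :=
        DFunLike.congr_fun (commute_mulOp g f) _
    _ = mulOp f (T (oneL2 ν)) := by rw [hg1]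
    _ = T (mulOp f (oneL2 ν)) := (DFunLike.congr_fun (hT f) _).symm

end MaximalAbelian

end Linfty

/-! ### Generated von Neumann algebras -/

section Generated

variable {H : Type*} [NormedAddCommGroup H] [InnerProductSpace ℂ H] [CompleteSpace H]

theorem mem_generated {S : Set (H →L[ℂ] H)} {x : H →L[ℂ] H} :
    x ∈ generated S ↔ ∀ T, (∀ a ∈ S, Commute a T ∧ Commute (star a) T) → Commute T x := by
  change x ∈ StarSubalgebra.centralizer ℂ _ ↔ _
  rw [StarSubalgebra.mem_centralizer_iff]
  exact ⟨fun h T hT => (h T ((StarSubalgebra.mem_centralizer_iff ℂ).2 hT)).1, fun h T hT =>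
    ⟨h T ((StarSubalgebra.mem_centralizer_iff ℂ).1 hT),
      h (star T) ((StarSubalgebra.mem_centralizer_iff ℂ).1 (star_mem hT))⟩⟩

theorem subset_generated (S : Set (H →L[ℂ] H)) : S ⊆ generated S := fun x hx =>
  mem_generated.2 fun _ hT => (hT x hx).1.symm

theorem mem_vonNeumannAlgebra_iff {A : VonNeumannAlgebra H} {x : H →L[ℂ] H} :
    x ∈ A ↔ ∀ T, (∀ a ∈ A, Commute a T) → Commute T x := by
  conv_lhs => rw [← A.commutant_commutant]
  simp only [VonNeumannAlgebra.mem_commutant_iff, commute_iff_eq]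

theorem generated_le_iff {S : Set (H →L[ℂ] H)} {A : VonNeumannAlgebra H} :
    generated S ≤ A ↔ S ⊆ A :=
  ⟨fun h => (subset_generated S).trans h, fun h _ hx => mem_vonNeumannAlgebra_iff.2 fun T hT =>
    mem_generated.1 hx T fun a ha => ⟨hT a (h ha), hT _ (star_mem (show a ∈ A from h ha))⟩⟩

theorem generated_mono {S T : Set (H →L[ℂ] H)} (h : S ⊆ T) : generated S ≤ generated T :=
  generated_le_iff.2 (h.trans (subset_generated T))

theorem mem_of_tendsto_apply {A : VonNeumannAlgebra H} {F : ℕ → H →L[ℂ] H} {x : H →L[ℂ] H}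
    (hF : ∀ n, F n ∈ A) (hx : ∀ ξ, Tendsto (fun n => F n ξ) atTop (𝓝 (x ξ))) : x ∈ A := by
  refine mem_vonNeumannAlgebra_iff.2 fun T hT => ContinuousLinearMap.ext fun ξ => ?_
  refine tendsto_nhds_unique ((T.continuous.tendsto _).comp (hx ξ)) ?_
  exact (hx (T ξ)).congr fun n => DFunLike.congr_fun (hT _ (hF n)) ξ

theorem smul_one_mem (A : VonNeumannAlgebra H) (c : ℂ) : c • (1 : H →L[ℂ] H) ∈ A := by
  rw [← Algebra.algebraMap_eq_smul_one]
  exact A.toStarSubalgebra.algebraMap_mem c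

end Generated

/-- Unlike `aestronglyMeasurable_of_tendsto_ae`, this allows a σ-algebra other than that of the
measure. -/
theorem aestronglyMeasurable_of_ae_tendsto {Y : Type*} {m m₀ : MeasurableSpace Y}
    {ν : Measure[m₀] Y} {g : ℕ → Y → ℂ} {f : Y → ℂ} (hg : ∀ n, AEStronglyMeasurable[m] (g n) ν)
    (hlim : ∀ᵐ y ∂ν, Tendsto (fun n => g n y) atTop (𝓝 (f y))) :
    AEStronglyMeasurable[m] f ν := by
  choose h hh hgh using hg
  refine ⟨_, @StronglyMeasurable.limUnder _ _ _ m _ _ atTop _ h _ _ hh, ?_⟩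
  filter_upwards [hlim, ae_all_iff.2 hgh] with y hy hgy
  simp only [hgy] at hy
  exact hy.limUnder_eq.symm

/-! ### Composition with a measurable map -/

section Pullback

variable {Y : Type uY} {Z : Type uZ} [MeasurableSpace Y] [MeasurableSpace Z]
  {ν : Measure Y} {ζ : Measure Z} {p : Y → Z} (hp : QuasiMeasurePreserving p ν ζ)

theorem coeFn_pullback (f : Lp ℂ ∞ ζ) : pullback p hp f =ᵐ[ν] f ∘ p :=
  MemLp.coeFn_toLp _

theorem pullback_eq_of_ae_eq {f : Lp ℂ ∞ ζ} {g : Lp ℂ ∞ ν} {h : Z → ℂ} (hf : f =ᵐ[ζ] h)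
    (hg : g =ᵐ[ν] h ∘ p) : pullback p hp f = g :=
  Lp.ext ((coeFn_pullback hp f).trans ((hp.ae_eq_comp hf).trans hg.symm))

theorem pullback_add (f g : Lp ℂ ∞ ζ) :
    pullback p hp (f + g) = pullback p hp f + pullback p hp g :=
  pullback_eq_of_ae_eq hp (Lp.coeFn_add f g) ((Lp.coeFn_add _ _).trans
    ((coeFn_pullback hp f).add (coeFn_pullback hp g)))

theorem pullback_mul (f g : Lp ℂ ∞ ζ) :
    pullback p hp (f • g : Lp ℂ ∞ ζ) = (pullback p hp f • pullback p hp g : Lp ℂ ∞ ν) :=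
  pullback_eq_of_ae_eq hp (Lp.coeFn_lpSMul (r := ∞) f g) ((Lp.coeFn_lpSMul (r := ∞) _ _).trans
    ((coeFn_pullback hp f).smul (coeFn_pullback hp g)))

theorem pullback_star (f : Lp ℂ ∞ ζ) : pullback p hp (star f) = star (pullback p hp f) :=
  pullback_eq_of_ae_eq hp (Lp.coeFn_star f) ((Lp.coeFn_star _).trans
    ((coeFn_pullback hp f).star))

theorem pullback_const [IsFiniteMeasure ν] [IsFiniteMeasure ζ] (c : ℂ) :
    pullback p hp (Lp.const ∞ ζ c) = Lp.const ∞ ν c :=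
  pullback_eq_of_ae_eq hp (Lp.coeFn_const ∞ ζ c) (Lp.coeFn_const ∞ ν c)

theorem BoundedAETendsto.pullback {F : ℕ → Lp ℂ ∞ ζ} {f : Lp ℂ ∞ ζ}
    (h : BoundedAETendsto F f) :
    BoundedAETendsto (fun n => pullback p hp (F n)) (pullback p hp f) where
  exists_norm_le := h.exists_norm_le.imp fun _ hC n => (norm_pullback_le p hp _).trans (hC n)
  ae_tendsto := by
    filter_upwards [hp.ae h.ae_tendsto, coeFn_pullback hp f,
      ae_all_iff.2 fun n => coeFn_pullback hp (F n)] with y hlim hf hF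
    simpa only [hf, hF, Function.comp_apply] using hlim

end Pullback

/-! ### Sequentially closed subalgebras of `L^∞` -/

section SeqClosed

variable {Y : Type uY} [MeasurableSpace Y] {ν : Measure Y} [IsFiniteMeasure ν]
  {N : Set (Lp ℂ ∞ ν)} {H : Type*} [NormedAddCommGroup H] [InnerProductSpace ℂ H] [CompleteSpace H]

/-- A unital ⋆-subalgebra of `L^∞` closed under bounded almost everywhere convergence of
sequences: the measure-theoretic description of the von Neumann subalgebras of `L^∞`. -/
structure IsSeqClosedAlgebra (N : Set (Lp ℂ ∞ ν)) : Prop where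
  const_mem (c : ℂ) : Lp.const ∞ ν c ∈ N
  add_mem {f g : Lp ℂ ∞ ν} : f ∈ N → g ∈ N → f + g ∈ N
  mul_mem {f g : Lp ℂ ∞ ν} : f ∈ N → g ∈ N → (f • g : Lp ℂ ∞ ν) ∈ N
  star_mem {f : Lp ℂ ∞ ν} : f ∈ N → star f ∈ N
  lim_mem {F : ℕ → Lp ℂ ∞ ν} {f : Lp ℂ ∞ ν} : (∀ n, F n ∈ N) → BoundedAETendsto F f → f ∈ N

theorem isSeqClosedAlgebra_univ : IsSeqClosedAlgebra (Set.univ : Set (Lp ℂ ∞ ν)) :=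
  ⟨fun _ => trivial, fun _ _ => trivial, fun _ _ => trivial, fun _ => trivial, fun _ _ => trivial⟩

theorem IsSeqClosedAlgebra.inter {N' : Set (Lp ℂ ∞ ν)} (hN : IsSeqClosedAlgebra N)
    (hN' : IsSeqClosedAlgebra N') : IsSeqClosedAlgebra (N ∩ N') where
  const_mem c := ⟨hN.const_mem c, hN'.const_mem c⟩
  add_mem hf hg := ⟨hN.add_mem hf.1 hg.1, hN'.add_mem hf.2 hg.2⟩
  mul_mem hf hg := ⟨hN.mul_mem hf.1 hg.1, hN'.mul_mem hf.2 hg.2⟩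
  star_mem hf := ⟨hN.star_mem hf.1, hN'.star_mem hf.2⟩
  lim_mem hF h := ⟨hN.lim_mem (fun n => (hF n).1) h, hN'.lim_mem (fun n => (hF n).2) h⟩

/-- A unital ⋆-representation of `L^∞` that turns bounded almost everywhere convergence into
strong operator convergence. -/
structure IsNormalRep (Φ : Lp ℂ ∞ ν → H →L[ℂ] H) : Prop where
  map_const (c : ℂ) : Φ (Lp.const ∞ ν c) = c • 1
  map_add (f g : Lp ℂ ∞ ν) : Φ (f + g) = Φ f + Φ g
  map_mul (f g : Lp ℂ ∞ ν) : Φ (f • g : Lp ℂ ∞ ν) = Φ f * Φ g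
  map_star (f : Lp ℂ ∞ ν) : Φ (star f) = star (Φ f)
  tendsto {F : ℕ → Lp ℂ ∞ ν} {f : Lp ℂ ∞ ν} (h : BoundedAETendsto F f) (ξ : H) :
    Tendsto (fun n => Φ (F n) ξ) atTop (𝓝 (Φ f ξ))

theorem IsNormalRep.isSeqClosedAlgebra_preimage {Φ : Lp ℂ ∞ ν → H →L[ℂ] H} (hΦ : IsNormalRep Φ)
    (A : VonNeumannAlgebra H) : IsSeqClosedAlgebra (Φ ⁻¹' A) where
  const_mem c := by
    rw [Set.mem_preimage, hΦ.map_const]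
    exact smul_one_mem A c
  add_mem {f g} hf hg := by
    rw [Set.mem_preimage, hΦ.map_add]
    exact add_mem (S := VonNeumannAlgebra H) hf hg
  mul_mem {f g} hf hg := by
    rw [Set.mem_preimage, hΦ.map_mul]
    exact mul_mem (S := VonNeumannAlgebra H) hf hg
  star_mem {f} hf := by
    rw [Set.mem_preimage, hΦ.map_star]
    exact star_mem (S := VonNeumannAlgebra H) hf
  lim_mem hF h := mem_of_tendsto_apply hF (hΦ.tendsto h)

theorem isNormalRep_mulOp : IsNormalRep (mulOp : Lp ℂ ∞ ν → Lp ℂ 2 ν →L[ℂ] Lp ℂ 2 ν) where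
  map_const := mulOp_const
  map_add := mulOp_add
  map_mul := mulOp_mul
  map_star := mulOp_star
  tendsto := BoundedAETendsto.tendsto_mulOp

theorem IsNormalRep.comp_pullback {Z : Type uZ} [MeasurableSpace Z] {ζ : Measure Z}
    [IsFiniteMeasure ζ] {p : Y → Z} (hp : QuasiMeasurePreserving p ν ζ)
    {Φ : Lp ℂ ∞ ν → H →L[ℂ] H} (hΦ : IsNormalRep Φ) :
    IsNormalRep fun f => Φ (pullback p hp f) where
  map_const c := by rw [pullback_const, hΦ.map_const]
  map_add f g := by rw [pullback_add, hΦ.map_add]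
  map_mul f g := by rw [pullback_mul, hΦ.map_mul]
  map_star f := by rw [pullback_star, hΦ.map_star]
  tendsto h := hΦ.tendsto (h.pullback hp)

theorem isSeqClosedAlgebra_setOf_aestronglyMeasurable {Y : Type*} (m : MeasurableSpace Y)
    {m₀ : MeasurableSpace Y} {ν : Measure[m₀] Y} [IsFiniteMeasure ν] :
    IsSeqClosedAlgebra {f : Lp ℂ ∞ ν | AEStronglyMeasurable[m] f ν} where
  const_mem c := aestronglyMeasurable_const.congr (Lp.coeFn_const ∞ ν c).symm
  add_mem hf hg := (hf.add hg).congr (Lp.coeFn_add _ _).symm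
  mul_mem {f g} hf hg := (hf.mul hg).congr (Lp.coeFn_lpSMul (r := ∞) f g).symm
  star_mem {f} hf := (continuous_star.comp_aestronglyMeasurable hf).congr (Lp.coeFn_star f).symm
  lim_mem hF h := aestronglyMeasurable_of_ae_tendsto hF h.ae_tendsto

end SeqClosed

/-! ### The σ-algebra of a sequentially closed subalgebra -/

section SigmaAlgebra

variable {Y : Type uY} [MeasurableSpace Y] {ν : Measure Y} {N : Set (Lp ℂ ∞ ν)}

/-- The function `h` represents an element of `N ⊆ L^∞`. -/
def ContainsClass (N : Set (Lp ℂ ∞ ν)) (h : Y → ℂ) : Prop :=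
  ∃ f ∈ N, f =ᵐ[ν] h

theorem containsClass_coeFn {f : Lp ℂ ∞ ν} : ContainsClass N f ↔ f ∈ N := by
  refine ⟨?_, fun hf => ⟨f, hf, .rfl⟩⟩
  rintro ⟨g, hg, hgf⟩
  rwa [← Lp.ext hgf]

theorem ContainsClass.congr {a b : Y → ℂ} (ha : ContainsClass N a) (hab : a =ᵐ[ν] b) :
    ContainsClass N b :=
  let ⟨f, hf, hfa⟩ := ha
  ⟨f, hf, hfa.trans hab⟩

namespace IsSeqClosedAlgebra

variable [IsFiniteMeasure ν] (hN : IsSeqClosedAlgebra N) {a b : Y → ℂ}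
include hN

theorem containsClass_const (c : ℂ) : ContainsClass N fun _ => c :=
  ⟨_, hN.const_mem c, Lp.coeFn_const ∞ ν c⟩

theorem containsClass_add (ha : ContainsClass N a) (hb : ContainsClass N b) :
    ContainsClass N (a + b) :=
  let ⟨f, hf, hfa⟩ := ha
  let ⟨g, hg, hgb⟩ := hb
  ⟨f + g, hN.add_mem hf hg, (Lp.coeFn_add f g).trans (hfa.add hgb)⟩

theorem containsClass_mul (ha : ContainsClass N a) (hb : ContainsClass N b) :
    ContainsClass N (a * b) :=
  let ⟨f, hf, hfa⟩ := ha
  let ⟨g, hg, hgb⟩ := hb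
  ⟨_, hN.mul_mem hf hg, (Lp.coeFn_lpSMul (r := ∞) f g).trans (hfa.mul hgb)⟩

theorem containsClass_star (ha : ContainsClass N a) : ContainsClass N (star a) :=
  let ⟨f, hf, hfa⟩ := ha
  ⟨_, hN.star_mem hf, (Lp.coeFn_star f).trans hfa.star⟩

theorem containsClass_of_tendsto {a : ℕ → Y → ℂ} {b : Y → ℂ} {C : ℝ} (hC : 0 ≤ C)
    (ha : ∀ n, ContainsClass N (a n)) (hb : ∀ n, ∀ᵐ y ∂ν, ‖a n y‖ ≤ C)
    (hlim : ∀ᵐ y ∂ν, Tendsto (fun n => a n y) atTop (𝓝 (b y))) : ContainsClass N b := by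
  choose F hFN hF using ha
  have hF' : ∀ᵐ y ∂ν, Tendsto (fun n => F n y) atTop (𝓝 (b y)) := by
    filter_upwards [hlim, ae_all_iff.2 hF] with y hy hFy
    simpa only [hFy] using hy
  have hbC : ∀ᵐ y ∂ν, ‖b y‖ ≤ C := by
    filter_upwards [hlim, ae_all_iff.2 hb] with y hy hby
    exact le_of_tendsto hy.norm (.of_forall hby)
  obtain ⟨f, hf⟩ := exists_linfty_ae_eq
    (aestronglyMeasurable_of_tendsto_ae atTop (fun n => Lp.aestronglyMeasurable (F n)) hF') hbC
  refine ⟨f, hN.lim_mem hFN ⟨⟨C, fun n => norm_le_of_ae_norm_le hC ?_⟩, ?_⟩, hf⟩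
  · filter_upwards [hF n, hb n] with y hFy hby
    rwa [hFy]
  · filter_upwards [hF', hf] with y hy hfy
    rwa [hfy]

/-- Weierstrass approximation on the disc of radius `‖f‖`. -/
theorem containsClass_comp_continuous {f : Lp ℂ ∞ ν} (hf : f ∈ N) {φ : ℂ → ℂ}
    (hφ : Continuous φ) : ContainsClass N (φ ∘ f) := by
  classical
  set K : Set ℂ := Metric.closedBall 0 ‖f‖
  have : CompactSpace K := isCompact_iff_compactSpace.1 (isCompact_closedBall _ _)
  have hzero : (0 : ℂ) ∈ K := Metric.mem_closedBall_self (norm_nonneg f)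
  set F : Y → K := fun y => if hy : f y ∈ K then ⟨f y, hy⟩ else ⟨0, hzero⟩
  have hF : ∀ᵐ y ∂ν, (F y : ℂ) = f y := by
    filter_upwards [ae_norm_le_norm f] with y hy
    have hyK : f y ∈ K := mem_closedBall_zero_iff.2 hy
    simp only [F, dif_pos hyK]
  have hmem (ψ : C(K, ℂ)) : ContainsClass N (ψ ∘ F) := by
    induction ψ using ContinuousMap.induction_on_of_compact with
    | const c => exact hN.containsClass_const c
    | id => exact (containsClass_coeFn.2 hf).congr (hF.mono fun y hy => hy.symm)
    | star_id =>
      exact (hN.containsClass_star (containsClass_coeFn.2 hf)).congr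
        (hF.mono fun y hy => congrArg star hy.symm)
    | add ψ₁ ψ₂ h₁ h₂ => exact hN.containsClass_add h₁ h₂
    | mul ψ₁ ψ₂ h₁ h₂ => exact hN.containsClass_mul h₁ h₂
    | frequently ψ hψ =>
      obtain ⟨u, hu, huψ⟩ := mem_closure_iff_seq_limit.1 (mem_closure_iff_frequently.2 hψ)
      obtain ⟨C, hC⟩ := (Metric.isBounded_range_of_tendsto u huψ).exists_norm_le
      have hC0 : 0 ≤ C := (norm_nonneg _).trans (hC _ ⟨0, rfl⟩)
      exact hN.containsClass_of_tendsto hC0 hu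
        (fun n => .of_forall fun y => ((u n).norm_coe_le_norm _).trans (hC _ ⟨n, rfl⟩))
        (.of_forall fun y => ((ContinuousEvalConst.continuous_eval_const (F y)).tendsto _).comp huψ)
  refine (hmem ⟨_, hφ.comp continuous_subtype_val⟩).congr ?_
  filter_upwards [hF] with y hy
  exact congrArg φ hy

variable {s t : Set Y}

theorem containsClass_indicator_compl (hs : ContainsClass N (s.indicator 1)) :
    ContainsClass N (sᶜ.indicator 1) := by
  rw [Set.indicator_compl, sub_eq_add_neg, ← neg_one_mul]
  exact hN.containsClass_add (hN.containsClass_const 1)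
    (hN.containsClass_mul (hN.containsClass_const (-1)) hs)

theorem containsClass_indicator_inter (hs : ContainsClass N (s.indicator 1))
    (ht : ContainsClass N (t.indicator 1)) : ContainsClass N ((s ∩ t).indicator 1) := by
  rw [Set.inter_indicator_one]
  exact hN.containsClass_mul hs ht

theorem containsClass_indicator_iUnion {s : ℕ → Set Y}
    (hs : ∀ n, ContainsClass N ((s n).indicator 1)) :
    ContainsClass N ((⋃ n, s n).indicator 1) := by
  have hunion (n : ℕ) : ContainsClass N ((⋃ i ∈ Finset.range n, s i).indicator 1) := by
    induction n with
    | zero => simpa using hN.containsClass_const 0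
    | succ n ih =>
      rw [Finset.range_add_one, Finset.set_biUnion_insert, ← compl_compl (_ ∪ _), Set.compl_union]
      exact hN.containsClass_indicator_compl (hN.containsClass_indicator_inter
        (hN.containsClass_indicator_compl (hs n)) (hN.containsClass_indicator_compl ih))
  refine hN.containsClass_of_tendsto zero_le_one hunion (fun n => .of_forall fun y => ?_)
    (.of_forall fun y => ?_)
  · exact (norm_indicator_le_norm_self _ _).trans_eq norm_one
  · exact ((tendsto_indicator_biUnion_finset s (1 : Y → ℂ) y).comp tendsto_finset_range).mono_right
      (pure_le_nhds _)

/-- The σ-algebra of sets whose indicator function belongs to the algebra. These sets need only be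
null-measurable. -/
@[reducible] def sigmaAlgebra (hN : IsSeqClosedAlgebra N) : MeasurableSpace Y where
  MeasurableSet' s := ContainsClass N (s.indicator 1)
  measurableSet_empty := by simpa using hN.containsClass_const 0
  measurableSet_compl _ := hN.containsClass_indicator_compl
  measurableSet_iUnion _ := hN.containsClass_indicator_iUnion

theorem measurable_sigmaAlgebra {f : Lp ℂ ∞ ν} (hf : f ∈ N) : Measurable[hN.sigmaAlgebra] f := by
  refine @measurable_of_isClosed _ _ _ _ _ hN.sigmaAlgebra _ fun C hC => ?_
  change ContainsClass N ((f ⁻¹' C).indicator 1)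
  have hδ (n : ℕ) : (0 : ℝ) < 1 / ((n : ℝ) + 1) := by positivity
  have hlim := thickenedIndicator_tendsto_indicator_closure hδ
    tendsto_one_div_add_atTop_nhds_zero_nat C
  rw [hC.closure_eq, tendsto_pi_nhds] at hlim
  set φ : ℕ → ℂ → ℂ := fun n z => ((thickenedIndicator (hδ n) C z : ℝ) : ℂ)
  have hcont (n : ℕ) : Continuous (φ n) := Complex.continuous_ofReal.comp
    (NNReal.continuous_coe.comp (thickenedIndicator (hδ n) C).continuous)
  refine hN.containsClass_of_tendsto zero_le_one
    (fun n => hN.containsClass_comp_continuous hf (hcont n))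
    (fun n => .of_forall fun y => ?_) (.of_forall fun y => ?_)
  · rw [Function.comp_apply, Complex.norm_real, Real.norm_of_nonneg (NNReal.coe_nonneg _)]
    exact_mod_cast thickenedIndicator_le_one (hδ n) C (f y)
  · have h := ((Complex.continuous_ofReal.comp NNReal.continuous_coe).tendsto _).comp (hlim (f y))
    have hind : (f ⁻¹' C).indicator 1 y = (Complex.ofReal ∘ NNReal.toReal)
        (C.indicator (fun _ => 1) (f y)) := by
      by_cases hy : f y ∈ C <;> simp [Set.indicator, hy]
    rwa [hind]

theorem mem_of_aestronglyMeasurable {f : Lp ℂ ∞ ν}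
    (hf : AEStronglyMeasurable[hN.sigmaAlgebra] f ν) : f ∈ N := by
  have hsimple (s : @SimpleFunc Y hN.sigmaAlgebra ℂ) : ContainsClass N s := by
    induction s using SimpleFunc.induction with
    | @const c s hs =>
      refine (hN.containsClass_mul (hN.containsClass_const c) hs).congr (.of_forall fun y => ?_)
      by_cases hy : y ∈ s <;> simp [hy]
    | add _ h₁ h₂ => exact hN.containsClass_add h₁ h₂
  obtain ⟨g, hg, hfg⟩ := hf
  refine containsClass_coeFn.1 (hN.containsClass_of_tendsto (norm_nonneg f)
    (fun n => hsimple (hg.approxBounded ‖f‖ n))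
    (fun n => .of_forall fun y => hg.norm_approxBounded_le (norm_nonneg _) n y) ?_)
  filter_upwards [hfg, ae_norm_le_norm f] with y hy hfy
  rw [hy] at hfy ⊢
  exact hg.tendsto_approxBounded_of_norm_le hfy

theorem mem_iff_aestronglyMeasurable {f : Lp ℂ ∞ ν} :
    f ∈ N ↔ AEStronglyMeasurable[hN.sigmaAlgebra] f ν :=
  ⟨fun hf => ⟨f, (hN.measurable_sigmaAlgebra hf).stronglyMeasurable, .rfl⟩,
    hN.mem_of_aestronglyMeasurable⟩

end IsSeqClosedAlgebra

end SigmaAlgebra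

/-! ### Sequentially closed subalgebras are von Neumann algebras -/

section Bicommutant

variable {Y : Type uY} [MeasurableSpace Y] {ν : Measure Y} [IsFiniteMeasure ν]
  {N : Set (Lp ℂ ∞ ν)}

namespace IsSeqClosedAlgebra

variable (hN : IsSeqClosedAlgebra N)
include hN

/-- An `L²`-convergent sequence in `N` has an almost everywhere convergent subsequence, so its limit
is measurable for the σ-algebra of `N`, even though the sequence need not be bounded. -/
theorem mem_of_mem_closure {f : Lp ℂ ∞ ν}
    (hf : mulOp f (oneL2 ν) ∈ closure ((fun g => mulOp g (oneL2 ν)) '' N)) : f ∈ N := by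
  obtain ⟨u, huN, hu⟩ := mem_closure_iff_seq_limit.1 hf
  choose g hgN hgu using huN
  obtain ⟨ns, -, hns⟩ := (tendstoInMeasure_of_tendsto_Lp hu).exists_seq_tendsto_ae
  refine hN.mem_iff_aestronglyMeasurable.2 (aestronglyMeasurable_of_ae_tendsto
    (fun k => hN.mem_iff_aestronglyMeasurable.1 (hgN (ns k))) ?_)
  filter_upwards [hns, coeFn_mulOp_one f, ae_all_iff.2 fun k => coeFn_mulOp_one (g k)]
    with y hlim hfy hgy
  simpa only [← hgu, hgy, hfy] using hlim

/-- The subspace `N·1` of `L²`. -/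
def orbitOne (hN : IsSeqClosedAlgebra N) : Submodule ℂ (Lp ℂ 2 ν) where
  carrier := (fun g => mulOp g (oneL2 ν)) '' N
  add_mem' := by
    rintro _ _ ⟨f, hf, rfl⟩ ⟨g, hg, rfl⟩
    exact ⟨f + g, hN.add_mem hf hg, by simp only [mulOp_add, _root_.add_apply]⟩
  zero_mem' := ⟨_, hN.const_mem 0, by simp only [mulOp_const, zero_smul, zero_apply]⟩
  smul_mem' := by
    rintro c _ ⟨f, hf, rfl⟩
    exact ⟨_, hN.mul_mem (hN.const_mem c) hf, by
      simp only [mulOp_mul, mulOp_const, smul_mul_assoc, one_mul, _root_.smul_apply]⟩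

theorem oneL2_mem_orbitOne : oneL2 ν ∈ hN.orbitOne :=
  ⟨_, hN.const_mem 1, by simp only [mulOp_const, one_smul, one_apply_eq_self]⟩

theorem mulOp_mem_topologicalClosure_orbitOne {f : Lp ℂ ∞ ν} (hf : f ∈ N) {ξ : Lp ℂ 2 ν}
    (hξ : ξ ∈ hN.orbitOne.topologicalClosure) :
    mulOp f ξ ∈ hN.orbitOne.topologicalClosure := by
  refine map_mem_closure (mulOp f).continuous hξ ?_
  rintro _ ⟨g, hg, rfl⟩
  exact ⟨_, hN.mul_mem hf hg, by simp only [mulOp_mul, mul_apply_eq_comp]⟩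

instance : CompleteSpace hN.orbitOne.topologicalClosure :=
  hN.orbitOne.isClosed_topologicalClosure.completeSpace_coe

theorem commute_mulOp_starProjection {f : Lp ℂ ∞ ν} (hf : f ∈ N) :
    Commute (mulOp f) hN.orbitOne.topologicalClosure.starProjection := by
  refine ContinuousLinearMap.ext fun ξ => ?_
  rw [mul_apply_eq_comp, mul_apply_eq_comp]
  refine (Submodule.eq_starProjection_of_mem_of_inner_eq_zero
    (hN.mulOp_mem_topologicalClosure_orbitOne hf (Submodule.starProjection_apply_mem _ _))
    fun η hη => ?_).symm
  rw [← map_sub, ← ContinuousLinearMap.adjoint_inner_right, ← ContinuousLinearMap.star_eq_adjoint,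
    ← mulOp_star]
  exact Submodule.starProjection_inner_eq_zero _ _
    (hN.mulOp_mem_topologicalClosure_orbitOne (hN.star_mem hf) hη)

theorem coe_generated :
    (generated (mulOp '' N) : Set (Lp ℂ 2 ν →L[ℂ] Lp ℂ 2 ν)) = mulOp '' N := by
  refine Set.Subset.antisymm (fun x hx => ?_) (subset_generated _)
  have hcomm (T : Lp ℂ 2 ν →L[ℂ] Lp ℂ 2 ν) (hT : ∀ f ∈ N, Commute (mulOp f) T) :
      Commute T x := by
    refine mem_generated.1 hx T ?_
    rintro _ ⟨f, hf, rfl⟩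
    exact ⟨hT f hf, mulOp_star f ▸ hT _ (hN.star_mem hf)⟩
  obtain ⟨f, rfl⟩ := exists_mulOp_eq_of_commute (T := x)
    fun f => (hcomm _ fun g _ => commute_mulOp g f).symm
  refine ⟨f, hN.mem_of_mem_closure ?_, rfl⟩
  have hproj := DFunLike.congr_fun (hcomm _ fun g => hN.commute_mulOp_starProjection) (oneL2 ν)
  rw [mul_apply_eq_comp, mul_apply_eq_comp, Submodule.starProjection_eq_self_iff.2
    (hN.orbitOne.le_topologicalClosure hN.oneL2_mem_orbitOne)] at hproj
  exact Submodule.starProjection_eq_self_iff.1 hproj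

end IsSeqClosedAlgebra

theorem isSeqClosedAlgebra_iff :
    IsSeqClosedAlgebra N ↔ ∃ A : VonNeumannAlgebra (Lp ℂ 2 ν), (A : Set _) = mulOp '' N := by
  refine ⟨fun hN => ⟨_, hN.coe_generated⟩, ?_⟩
  rintro ⟨A, hA⟩
  rw [← Set.preimage_image_eq N mulOp_injective, ← hA]
  exact isNormalRep_mulOp.isSeqClosedAlgebra_preimage A

end Bicommutant

/-! ### Operators on `ℓ²(ι, H)` -/

section Entries

theorem tendsto_lp_of_dominated {ι : Type*} {E : ι → Type*} [∀ i, NormedAddCommGroup (E i)]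
    {p : ℝ≥0∞} [Fact (1 ≤ p)] (hp : p ≠ ∞) {F : ℕ → lp E p} {f b : lp E p}
    (hb : ∀ n i, ‖F n i‖ ≤ ‖b i‖) (hlim : ∀ i, Tendsto (fun n => F n i) atTop (𝓝 (f i))) :
    Tendsto F atTop (𝓝 f) := by
  have hpos : 0 < p.toReal := ENNReal.toReal_pos (zero_lt_one.trans_le Fact.out).ne' hp
  have hf (i : ι) : ‖f i‖ ≤ ‖b i‖ := le_of_tendsto (hlim i).norm (.of_forall fun n => hb n i)
  have hdom (n : ℕ) (i : ι) : ‖F n i - f i‖ ≤ 2 * ‖b i‖ :=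
    (norm_sub_le _ _).trans (by linarith [hb n i, hf i])
  have hsum : Summable fun i => (2 * ‖b i‖) ^ p.toReal := by
    simp only [Real.mul_rpow zero_le_two (norm_nonneg _)]
    exact ((lp.memℓp b).summable hpos).mul_left _
  have htsum : Tendsto (fun n => ∑' i, ‖F n i - f i‖ ^ p.toReal) atTop (𝓝 (∑' _ : ι, 0)) := by
    refine tendsto_tsum_of_dominated_convergence hsum (fun i => ?_) (.of_forall fun n i => ?_)
    · simpa [hpos.ne'] using ((hlim i).sub_const (f i)).norm.rpow_const (.inr hpos.le)
    · rw [Real.norm_of_nonneg (by positivity)]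
      exact Real.rpow_le_rpow (norm_nonneg _) (hdom n i) hpos.le
  rw [tendsto_iff_norm_sub_tendsto_zero]
  simp only [lp.norm_eq_tsum_rpow hpos, lp.coeFn_sub, Pi.sub_apply]
  simpa [hpos.ne'] using htsum.rpow_const (p := 1 / p.toReal) (.inr (by positivity))

variable {ι H : Type*} [NormedAddCommGroup H]

section Normed

variable [NormedSpace ℂ H] {x y : lp (fun _ : ι => H) 2 →L[ℂ] lp (fun _ : ι => H) 2}

open scoped Classical in
/-- The matrix entry at position `(s, t)` of an operator on `ℓ²(ι, H)`. -/
def entry (x : lp (fun _ : ι => H) 2 →L[ℂ] lp (fun _ : ι => H) 2) (s t : ι) : H →L[ℂ] H :=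
  lp.evalCLM ℂ (fun _ : ι => H) 2 s ∘L x ∘L lp.singleContinuousLinearMap ℂ (fun _ : ι => H) 2 t

theorem hasSum_entry_apply (x : lp (fun _ : ι => H) 2 →L[ℂ] lp (fun _ : ι => H) 2) (s : ι)
    (ξ : lp (fun _ : ι => H) 2) : HasSum (fun r => entry x s r (ξ r)) (x ξ s) := by
  classical
  exact (lp.hasSum_single ENNReal.ofNat_ne_top ξ).mapL (lp.evalCLM ℂ (fun _ : ι => H) 2 s ∘L x)

theorem ext_entry (h : ∀ s t, entry x s t = entry y s t) : x = y := by
  ext1 ξ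
  ext s : 2
  refine (hasSum_entry_apply x s ξ).unique ?_
  simp only [h]
  exact hasSum_entry_apply y s ξ

theorem hasSum_entry_mul (x y : lp (fun _ : ι => H) 2 →L[ℂ] lp (fun _ : ι => H) 2) (s t : ι)
    (ξ : H) : HasSum (fun r => entry x s r (entry y r t ξ)) (entry (x * y) s t ξ) := by
  classical
  exact hasSum_entry_apply x s (y (lp.single 2 t ξ))

theorem entry_add (x y : lp (fun _ : ι => H) 2 →L[ℂ] lp (fun _ : ι => H) 2) (s t : ι) :
    entry (x + y) s t = entry x s t + entry y s t := by
  simp only [entry, ContinuousLinearMap.comp_add, ContinuousLinearMap.add_comp]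

theorem entry_smul (c : ℂ) (x : lp (fun _ : ι => H) 2 →L[ℂ] lp (fun _ : ι => H) 2) (s t : ι) :
    entry (c • x) s t = c • entry x s t := by
  simp only [entry, ContinuousLinearMap.comp_smul, ContinuousLinearMap.smul_comp]

open scoped Classical in
theorem tendsto_apply_of_tendsto_single
    {F : ℕ → lp (fun _ : ι => H) 2 →L[ℂ] lp (fun _ : ι => H) 2}
    {C : ℝ} (hC : ∀ n, ‖F n‖ ≤ C)
    (hF : ∀ t ξ, Tendsto (fun n => F n (lp.single 2 t ξ)) atTop (𝓝 (x (lp.single 2 t ξ))))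
    (ξ : lp (fun _ : ι => H) 2) : Tendsto (fun n => F n ξ) atTop (𝓝 (x ξ)) := by
  have hbound : ∃ C, ∀ n, ‖F n‖ ≤ C := ⟨C, hC⟩
  have hequi : Equicontinuous ((↑) ∘ F) := ((NormedSpace.equicontinuous_TFAE F).out 5 1).1 hbound
  refine (hequi.isClosed_setOfPred_tendsto x.continuous).mem_of_tendsto
    (lp.hasSum_single ENNReal.ofNat_ne_top ξ) (.of_forall fun S => ?_)
  simp only [Set.mem_ofPred_eq, Function.comp_apply, _root_.map_sum]
  exact tendsto_finsetSum S fun t _ => hF t (ξ t)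

section Diagonal

variable {T : ι → H →L[ℂ] H} {C : ℝ} (hT : ∀ i, ‖T i‖ ≤ C)

theorem diagOp_apply (ξ : lp (fun _ : ι => H) 2) (i : ι) : diagOp T C hT ξ i = T i (ξ i) := rfl

theorem norm_diagOp_le : ‖diagOp T C hT‖ ≤ |C| := by
  rw [diagOp]
  exact LinearMap.mkContinuous_norm_le _ (abs_nonneg C) _

theorem entry_diagOp_mul (x : lp (fun _ : ι => H) 2 →L[ℂ] lp (fun _ : ι => H) 2) (s t : ι) :
    entry (diagOp T C hT * x) s t = T s * entry x s t := rfl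

open scoped Classical in
theorem diagOp_single (t : ι) (ξ : H) :
    diagOp T C hT (lp.single 2 t ξ) = lp.single 2 t (T t ξ) := by
  ext i : 2
  rw [diagOp_apply, lp.single_apply, lp.single_apply, Pi.apply_single fun i => T i]
  exact fun i => map_zero (T i)

theorem entry_mul_diagOp (x : lp (fun _ : ι => H) 2 →L[ℂ] lp (fun _ : ι => H) 2) (s t : ι) :
    entry (x * diagOp T C hT) s t = entry x s t * T t := by
  classical
  ext1 ξ
  exact congrArg (fun η => x η s) (diagOp_single hT t ξ)

theorem entry_diagOp (s t : ι) [Decidable (s = t)] :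
    entry (diagOp T C hT) s t = if s = t then T s else 0 := by
  classical
  ext1 ξ
  change diagOp T C hT (lp.single 2 t ξ) s = _
  rw [diagOp_single, lp.single_apply]
  split_ifs with h
  · subst h
    rw [Pi.single_eq_same]
  · rw [Pi.single_eq_of_ne h, zero_apply]

end Diagonal

theorem reindexOp_apply (e : ι ≃ ι) (ξ : lp (fun _ : ι => H) 2) (i : ι) :
    reindexOp e ξ i = ξ (e i) := rfl

open scoped Classical in
theorem reindexOp_single (e : ι ≃ ι) (t : ι) (ξ : H) :
    reindexOp e (lp.single 2 t ξ) = lp.single 2 (e.symm t) ξ := by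
  ext i : 2
  rw [reindexOp_apply, lp.single_apply, lp.single_apply]
  simp only [Pi.single_apply, e.eq_symm_apply]

theorem entry_mul_reindexOp (e : ι ≃ ι)
    (x : lp (fun _ : ι => H) 2 →L[ℂ] lp (fun _ : ι => H) 2) (s t : ι) :
    entry (x * reindexOp e) s t = entry x s (e.symm t) := by
  classical
  ext1 ξ
  exact congrArg (fun η => x η s) (reindexOp_single e t ξ)

end Normed

variable [InnerProductSpace ℂ H] [CompleteSpace H]

theorem star_diagOp {T T' : ι → H →L[ℂ] H} {C C' : ℝ} (hT : ∀ i, ‖T i‖ ≤ C)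
    (hT' : ∀ i, ‖T' i‖ ≤ C') (h : ∀ i, T' i = star (T i)) :
    star (diagOp T C hT) = diagOp T' C' hT' := by
  rw [ContinuousLinearMap.star_eq_adjoint, eq_comm, ContinuousLinearMap.eq_adjoint_iff]
  intro ξ η
  simp only [lp.inner_eq_tsum, diagOp_apply, h, ContinuousLinearMap.star_eq_adjoint,
    ContinuousLinearMap.adjoint_inner_left]

theorem star_reindexOp (e : ι ≃ ι) :
    star (reindexOp e : lp (fun _ : ι => H) 2 →L[ℂ] _) = reindexOp e.symm := by
  rw [ContinuousLinearMap.star_eq_adjoint, eq_comm, ContinuousLinearMap.eq_adjoint_iff]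
  intro ξ η
  simp only [lp.inner_eq_tsum, reindexOp_apply]
  rw [← e.tsum_eq]
  simp only [e.symm_apply_apply]

theorem IsNormalRep.diagOp {Y : Type uY} [MeasurableSpace Y] {ν : Measure Y} [IsFiniteMeasure ν]
    {Φ : ι → Lp ℂ ∞ ν → H →L[ℂ] H} (hΦ : ∀ i, IsNormalRep (Φ i))
    (hbound : ∀ f i, ‖Φ i f‖ ≤ ‖f‖) :
    IsNormalRep fun f => diagOp (fun i => Φ i f) ‖f‖ (hbound f) where
  map_const c := by
    ext1 ξ
    ext i : 2
    exact DFunLike.congr_fun ((hΦ i).map_const c) (ξ i)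
  map_add f g := by
    ext1 ξ
    ext i : 2
    exact DFunLike.congr_fun ((hΦ i).map_add f g) (ξ i)
  map_mul f g := by
    ext1 ξ
    ext i : 2
    exact DFunLike.congr_fun ((hΦ i).map_mul f g) (ξ i)
  map_star f := (star_diagOp _ _ fun i => (hΦ i).map_star f).symm
  tendsto {F f} h ξ := by
    obtain ⟨C, hC⟩ := h.exists_norm_le
    refine tendsto_lp_of_dominated ENNReal.ofNat_ne_top (b := (C : ℂ) • ξ) (fun n i => ?_)
      fun i => (hΦ i).tendsto h (ξ i)
    calc ‖Φ i (F n) (ξ i)‖ ≤ ‖Φ i (F n)‖ * ‖ξ i‖ := (Φ i (F n)).le_opNorm _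
      _ ≤ |C| * ‖ξ i‖ := by
        gcongr
        exact (hbound _ _).trans ((hC n).trans (le_abs_self C))
      _ = ‖((C : ℂ) • ξ) i‖ := by
        rw [lp.coeFn_smul, Pi.smul_apply, norm_smul, Complex.norm_real, Real.norm_eq_abs]

end Entries

/-! ### The action on `L^∞` and its Koopman implementation on `L²` -/

theorem enorm_sqrt_toReal_rpow {a : ℝ≥0∞} (ha : a ≠ ∞) : ‖(√a.toReal : ℂ)‖ₑ ^ (2 : ℝ) = a := by
  rw [← ofReal_norm, Complex.norm_real, Real.norm_of_nonneg (Real.sqrt_nonneg _),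
    ENNReal.ofReal_rpow_of_nonneg (Real.sqrt_nonneg _) zero_le_two, Real.rpow_two,
    Real.sq_sqrt ENNReal.toReal_nonneg, ENNReal.ofReal_toReal ha]

section Koopman

variable {Γ : Type uΓ} [Group Γ] {Y : Type uY} [MeasurableSpace Y] [MulAction Γ Y]

variable (ν : Measure Y) [NonsingularAction Γ ν] in
theorem ae_smul (s : Γ) {P : Y → Prop} (h : ∀ᵐ y ∂ν, P y) : ∀ᵐ y ∂ν, P (s • y) :=
  (NonsingularAction.quasi (μ := ν) s).ae h

variable {ν : Measure Y} [NonsingularAction Γ ν]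

theorem coeFn_translate (s : Γ) (f : Lp ℂ ∞ ν) : translate s f =ᵐ[ν] fun y => f (s⁻¹ • y) :=
  coeFn_pullback _ f

theorem norm_translate_le (s : Γ) (f : Lp ℂ ∞ ν) : ‖translate s f‖ ≤ ‖f‖ :=
  norm_pullback_le _ _ f

theorem translate_mul (s t : Γ) (f : Lp ℂ ∞ ν) :
    translate (s * t) f = translate s (translate t f) := by
  refine Lp.ext ?_
  filter_upwards [coeFn_translate (s * t) f, coeFn_translate s (translate t f),
    ae_smul ν s⁻¹ (coeFn_translate t f)] with y h₁ h₂ h₃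
  rw [h₁, h₂, h₃, mul_inv_rev, mul_smul]

theorem translate_one (f : Lp ℂ ∞ ν) : translate (1 : Γ) f = f := by
  refine Lp.ext ?_
  filter_upwards [coeFn_translate (1 : Γ) f] with y hy
  rw [hy, inv_one, one_smul]

theorem absolutelyContinuous_map_smul (g : Γ) : ν ≪ ν.map (g • ·) := by
  have hmeas (s : Γ) : Measurable fun y : Y => s • y :=
    (NonsingularAction.quasi (μ := ν) s).measurable
  have h := (NonsingularAction.quasi (μ := ν) g⁻¹).absolutelyContinuous.map (hmeas g)
  rw [Measure.map_map (hmeas g) (hmeas g⁻¹)] at h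
  simpa only [Function.comp_def, smul_inv_smul, Measure.map_id'] using h

variable (ν) in
/-- The weight `(d(g_*ν)/dν)^{1/2}` that makes `ξ ↦ ξ (g⁻¹ • ·)` isometric on `L²(Y)`. -/
def koopmanWeight (g : Γ) (y : Y) : ℝ := √((ν.map (g • ·)).rnDeriv ν y).toReal

variable [IsFiniteMeasure ν] (g : Γ)

theorem koopmanWeight_ne_zero : ∀ᵐ y ∂ν, koopmanWeight ν g y ≠ 0 := by
  have hpos := Measure.rnDeriv_pos (NonsingularAction.quasi (μ := ν) g).absolutelyContinuous
  filter_upwards [(absolutelyContinuous_map_smul g).ae_le hpos,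
    Measure.rnDeriv_lt_top (ν.map (g • ·)) ν] with y h₁ h₂
  exact (Real.sqrt_pos.2 (ENNReal.toReal_pos h₁.ne' h₂.ne)).ne'

theorem eLpNorm_koopmanWeight_mul (ξ : Lp ℂ 2 ν) :
    eLpNorm (fun y => (koopmanWeight ν g y : ℂ) * ξ (g⁻¹ • y)) 2 ν = eLpNorm ξ 2 ν := by
  have hac := (NonsingularAction.quasi (μ := ν) g).absolutelyContinuous
  have hmeas : AEMeasurable (fun y => ‖ξ (g⁻¹ • y)‖ₑ ^ (2 : ℝ)) ν :=
    ((Lp.aestronglyMeasurable ξ).comp_quasiMeasurePreserving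
      (NonsingularAction.quasi g⁻¹)).enorm.pow_const _
  simp only [eLpNorm_eq_lintegral_rpow_enorm_toReal two_ne_zero ENNReal.ofNat_ne_top,
    ENNReal.toReal_ofNat]
  congr 1
  calc ∫⁻ y, ‖(koopmanWeight ν g y : ℂ) * ξ (g⁻¹ • y)‖ₑ ^ (2 : ℝ) ∂ν
      = ∫⁻ y, (ν.map (g • ·)).rnDeriv ν y * ‖ξ (g⁻¹ • y)‖ₑ ^ (2 : ℝ) ∂ν := by
        refine lintegral_congr_ae ?_
        filter_upwards [Measure.rnDeriv_lt_top (ν.map (g • ·)) ν] with y hy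
        rw [enorm_mul, ENNReal.mul_rpow_of_nonneg _ _ zero_le_two, koopmanWeight,
          enorm_sqrt_toReal_rpow hy.ne]
    _ = ∫⁻ y, ‖ξ (g⁻¹ • y)‖ₑ ^ (2 : ℝ) ∂(ν.map (g • ·)) := lintegral_rnDeriv_mul hac hmeas
    _ = ∫⁻ y, ‖ξ y‖ₑ ^ (2 : ℝ) ∂ν := by
        rw [lintegral_map' (hmeas.mono_ac hac)
          (NonsingularAction.quasi (μ := ν) g).measurable.aemeasurable]
        simp only [inv_smul_smul]

theorem memLp_koopmanWeight_mul (ξ : Lp ℂ 2 ν) :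
    MemLp (fun y => (koopmanWeight ν g y : ℂ) * ξ (g⁻¹ • y)) 2 ν := by
  have hweight : Measurable (koopmanWeight ν g) :=
    (Measure.measurable_rnDeriv _ ν).ennreal_toReal.sqrt
  refine ⟨(Complex.measurable_ofReal.comp hweight).aestronglyMeasurable.mul
    ((Lp.aestronglyMeasurable ξ).comp_quasiMeasurePreserving (NonsingularAction.quasi g⁻¹)), ?_⟩
  rw [eLpNorm_koopmanWeight_mul]
  exact Lp.eLpNorm_lt_top ξ

/-- The Koopman operator of `g` on `L²(Y)`, which implements the action of `g` on `L^∞(Y)`. -/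
def koopman : Lp ℂ 2 ν →L[ℂ] Lp ℂ 2 ν :=
  LinearMap.mkContinuous
    { toFun := fun ξ => (memLp_koopmanWeight_mul g ξ).toLp _
      map_add' := fun ξ η => by
        rw [← MemLp.toLp_add]
        refine MemLp.toLp_congr _ _ ?_
        filter_upwards [ae_smul ν g⁻¹ (Lp.coeFn_add ξ η)] with y hy
        simp only [hy, Pi.add_apply, mul_add]
      map_smul' := fun c ξ => by
        rw [RingHom.id_apply, ← MemLp.toLp_const_smul]
        refine MemLp.toLp_congr _ _ ?_
        filter_upwards [ae_smul ν g⁻¹ (Lp.coeFn_smul c ξ)] with y hy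
        simp only [hy, Pi.smul_apply, mul_smul_comm] }
    1 fun ξ => by
      rw [LinearMap.coe_mk, AddHom.coe_mk, Lp.norm_toLp, eLpNorm_koopmanWeight_mul, one_mul,
        Lp.norm_def]

theorem coeFn_koopman (ξ : Lp ℂ 2 ν) :
    koopman g ξ =ᵐ[ν] fun y => (koopmanWeight ν g y : ℂ) * ξ (g⁻¹ • y) :=
  (memLp_koopmanWeight_mul g ξ).coeFn_toLp

theorem koopman_mul_mulOp (f : Lp ℂ ∞ ν) :
    koopman g * mulOp f = mulOp (translate g f) * koopman g := by
  ext1 ξ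
  change koopman g (mulOp f ξ) = mulOp (translate g f) (koopman g ξ)
  refine (mulOp_apply_eq ?_).symm
  filter_upwards [coeFn_koopman g (mulOp f ξ), coeFn_koopman g ξ, coeFn_translate g f,
    ae_smul ν g⁻¹ (coeFn_mulOp f ξ)] with y h₁ h₂ h₃ h₄
  rw [h₁, h₂, h₃, h₄, mul_left_comm]

theorem eq_of_mulOp_mul_koopman {f f' : Lp ℂ ∞ ν}
    (h : mulOp f * koopman g = mulOp f' * koopman g) : f = f' := by
  refine Lp.ext ?_
  have hone := DFunLike.congr_fun h (oneL2 ν)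
  have hξ : ∀ᵐ y ∂ν, koopman g (oneL2 ν) y ≠ 0 := by
    filter_upwards [coeFn_koopman g (oneL2 ν), ae_smul ν g⁻¹ (Lp.coeFn_const 2 ν (1 : ℂ)),
      koopmanWeight_ne_zero (ν := ν) g] with y h₁ h₂ h₃
    rw [h₁, oneL2, h₂]
    simpa using h₃
  filter_upwards [coeFn_mulOp f (koopman g (oneL2 ν)), coeFn_mulOp f' (koopman g (oneL2 ν)), hξ]
    with y h₁ h₂ h₃
  refine mul_right_cancel₀ h₃ ?_
  rw [← h₁, ← h₂]
  exact congrArg (fun η : Lp ℂ 2 ν => η y) hone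

end Koopman

/-! ### Fourier coefficients in the crossed product -/

section Fourier

variable {Γ : Type uΓ} [Group Γ] {Y : Type uY} [MeasurableSpace Y] {ν : Measure Y}
  {x : RegularSpace Γ ν →L[ℂ] RegularSpace Γ ν}

theorem entry_groupOp_mul (g : Γ) (x : RegularSpace Γ ν →L[ℂ] RegularSpace Γ ν) (s t : Γ) :
    entry (groupOp ν g * x) s t = entry x (g⁻¹ * s) t := rfl

theorem entry_mul_groupOp (g : Γ) (x : RegularSpace Γ ν →L[ℂ] RegularSpace Γ ν) (s t : Γ) :
    entry (x * groupOp ν g) s t = entry x s (g * t) := by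
  rw [groupOp, entry_mul_reindexOp, Equiv.mulLeft_symm_apply, inv_inv]

theorem star_groupOp (g : Γ) : star (groupOp ν g) = groupOp ν g⁻¹ := by
  rw [groupOp, star_reindexOp, groupOp, Equiv.mulLeft_symm]

variable [MulAction Γ Y] [NonsingularAction Γ ν]

theorem norm_mulOp_translate_le (f : Lp ℂ ∞ ν) (t : Γ) : ‖mulOp (translate t f)‖ ≤ ‖f‖ :=
  (norm_mulOp_le _).trans (norm_translate_le t f)

theorem entry_coeffOp_mul (f : Lp ℂ ∞ ν) (x : RegularSpace Γ ν →L[ℂ] RegularSpace Γ ν) (s t : Γ) :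
    entry (coeffOp Γ f * x) s t = mulOp (translate s⁻¹ f) * entry x s t := rfl

theorem entry_mul_coeffOp (f : Lp ℂ ∞ ν) (x : RegularSpace Γ ν →L[ℂ] RegularSpace Γ ν) (s t : Γ) :
    entry (x * coeffOp Γ f) s t = entry x s t * mulOp (translate t⁻¹ f) :=
  entry_mul_diagOp _ _ _ _

theorem groupOp_mul_coeffOp (g : Γ) (f : Lp ℂ ∞ ν) :
    groupOp ν g * coeffOp Γ f = coeffOp Γ (translate g f) * groupOp ν g := by
  ext1 ξ
  ext t : 2
  change mulOp (translate (g⁻¹ * t)⁻¹ f) (ξ (g⁻¹ * t)) =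
    mulOp (translate t⁻¹ (translate g f)) (ξ (g⁻¹ * t))
  rw [← translate_mul, mul_inv_rev, inv_inv]

theorem isNormalRep_coeffOp [IsFiniteMeasure ν] :
    IsNormalRep (coeffOp Γ : Lp ℂ ∞ ν → RegularSpace Γ ν →L[ℂ] RegularSpace Γ ν) :=
  .diagOp (fun t => isNormalRep_mulOp.comp_pullback (NonsingularAction.quasi t⁻¹⁻¹))
    fun f t => norm_mulOp_translate_le f t⁻¹

/-- The function `c` gives the Fourier coefficients of `x`, that is, `x = ∑ g, c g * u_g`
formally. -/
def HasFourierCoeff (x : RegularSpace Γ ν →L[ℂ] RegularSpace Γ ν) (c : Γ → Lp ℂ ∞ ν) : Prop :=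
  ∀ s t, entry x s t = mulOp (translate s⁻¹ (c (s * t⁻¹)))

theorem HasFourierCoeff.mul_groupOp {c : Γ → Lp ℂ ∞ ν} (hc : HasFourierCoeff x c) (g : Γ) :
    HasFourierCoeff (x * groupOp ν g) fun h => c (h * g⁻¹) := fun s t => by
  simp only [entry_mul_groupOp, hc s, mul_inv_rev, mul_assoc]

variable {N : Set (Lp ℂ ∞ ν)}

theorem mem_crossedProduct_iff [IsFiniteMeasure ν] (hN : ∀ f ∈ N, star f ∈ N) :
    x ∈ crossedProduct Γ N ↔ ∀ T : RegularSpace Γ ν →L[ℂ] RegularSpace Γ ν,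
      (∀ f ∈ N, Commute (coeffOp Γ f) T) → (∀ g : Γ, Commute (groupOp ν g) T) → Commute T x := by
  rw [crossedProduct, mem_generated]
  refine forall_congr' fun T => ⟨fun h hcoeff hgroup => h ?_, fun h hT => h (fun f hf => ?_)
    fun g => ?_⟩
  · rintro _ (⟨f, hf, rfl⟩ | ⟨g, rfl⟩)
    · rw [← isNormalRep_coeffOp.map_star]
      exact ⟨hcoeff f hf, hcoeff _ (hN f hf)⟩
    · rw [star_groupOp]
      exact ⟨hgroup g, hgroup g⁻¹⟩
  · exact (hT _ (.inl ⟨f, hf, rfl⟩)).1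
  · exact (hT _ (.inr ⟨g, rfl⟩)).1

theorem HasFourierCoeff.mem_crossedProduct [IsFiniteMeasure ν] {c : Γ → Lp ℂ ∞ ν}
    (hx : HasFourierCoeff x c) (hN : ∀ f ∈ N, star f ∈ N) (hc : ∀ g, c g ∈ N) :
    x ∈ crossedProduct Γ N := by
  rw [mem_crossedProduct_iff hN]
  intro T hcoeff hgroup
  have hinvariant (g s t : Γ) : entry T (g * s) (g * t) = entry T s t := by
    rw [← entry_mul_groupOp, ← (hgroup g).eq, entry_groupOp_mul, inv_mul_cancel_left]
  have hintertwine (g s t : Γ) : mulOp (translate s⁻¹ (c g)) * entry T s t =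
      entry T s t * mulOp (translate t⁻¹ (c g)) := by
    rw [← entry_coeffOp_mul, (hcoeff _ (hc g)).eq, entry_mul_coeffOp]
  refine ext_entry fun s t => ?_
  ext1 ξ
  -- the term `r` of `entry (x * T) s t` is the term `s * r⁻¹ * t` of `entry (T * x) s t`
  let e : Γ ≃ Γ := (Equiv.inv Γ).trans ((Equiv.mulLeft s).trans (Equiv.mulRight t))
  refine ((e.hasSum_iff.2 (hasSum_entry_mul T x s t ξ)).unique
    ((hasSum_entry_mul x T s t ξ).congr_fun fun r => ?_))
  change (entry T s (s * r⁻¹ * t) * entry x (s * r⁻¹ * t) t) ξ = (entry x s r * entry T r t) ξ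
  have hshift : entry T r t = entry T s (s * r⁻¹ * t) := by
    rw [← hinvariant (s * r⁻¹) r t, inv_mul_cancel_right]
  rw [hx, hx, mul_inv_cancel_right, ← hintertwine, hshift]

variable [IsFiniteMeasure ν]

theorem exists_entry_eq_mulOp (hN : IsSeqClosedAlgebra N)
    (hinv : ∀ s : Γ, ∀ f ∈ N, translate s f ∈ N) (hx : x ∈ crossedProduct Γ N) (s t : Γ) :
    ∃ f ∈ N, mulOp f = entry x s t := by
  rw [mem_crossedProduct_iff fun _ => hN.star_mem] at hx
  change entry x s t ∈ mulOp '' N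
  rw [← hN.coe_generated, SetLike.mem_coe, mem_generated]
  intro T hT
  have hcomm := hx (diagOp (fun _ => T) ‖T‖ fun _ => le_rfl) (fun f hf => ?_) fun g => ?_
  · have hentry := congrArg (fun x => entry x s t) hcomm.eq
    simp only [entry_diagOp_mul, entry_mul_diagOp] at hentry
    exact hentry
  · ext1 ξ
    ext i : 2
    exact DFunLike.congr_fun (hT _ ⟨_, hinv _ f hf, rfl⟩).1.eq (ξ i)
  · ext1 ξ
    rfl

variable (ν) in
/-- The unitary `(ξ t)ₜ ↦ (W_g (ξ (t * g)))ₜ`, with `W_g` the Koopman operator of `g`; it lies in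
the commutant of `L^∞(Y) ⋊ Γ`. -/
def rightTranslation (g : Γ) : RegularSpace Γ ν →L[ℂ] RegularSpace Γ ν :=
  diagOp (fun _ => koopman g) ‖koopman (ν := ν) g‖ (fun _ => le_rfl) * reindexOp (Equiv.mulRight g)

theorem entry_rightTranslation_mul (g : Γ) (x : RegularSpace Γ ν →L[ℂ] RegularSpace Γ ν)
    (s t : Γ) : entry (rightTranslation ν g * x) s t = koopman g * entry x (s * g) t := rfl

theorem entry_mul_rightTranslation (g : Γ) (x : RegularSpace Γ ν →L[ℂ] RegularSpace Γ ν)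
    (s t : Γ) : entry (x * rightTranslation ν g) s t = entry x s (t * g⁻¹) * koopman g := by
  rw [rightTranslation, ← mul_assoc, entry_mul_reindexOp, entry_mul_diagOp,
    Equiv.mulRight_symm_apply]

theorem commute_groupOp_rightTranslation (g h : Γ) :
    Commute (groupOp ν g) (rightTranslation ν h) := by
  ext1 ξ
  ext t : 2
  change koopman h (ξ (g⁻¹ * t * h)) = koopman h (ξ (g⁻¹ * (t * h)))
  rw [mul_assoc]

theorem commute_coeffOp_rightTranslation (f : Lp ℂ ∞ ν) (h : Γ) :
    Commute (coeffOp Γ f) (rightTranslation ν h) := by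
  ext1 ξ
  ext t : 2
  have hop : mulOp (translate t⁻¹ f) * koopman h =
      koopman h * mulOp (translate (t * h)⁻¹ f) := by
    rw [koopman_mul_mulOp, ← translate_mul, mul_inv_rev, mul_inv_cancel_left]
  exact DFunLike.congr_fun hop (ξ (t * h))

theorem exists_hasFourierCoeff (hN : IsSeqClosedAlgebra N)
    (hinv : ∀ s : Γ, ∀ f ∈ N, translate s f ∈ N) (hx : x ∈ crossedProduct Γ N) :
    ∃ c : Γ → Lp ℂ ∞ ν, (∀ g, c g ∈ N) ∧ HasFourierCoeff x c := by
  choose c hcN hc using exists_entry_eq_mulOp hN hinv hx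
  rw [mem_crossedProduct_iff fun _ => hN.star_mem] at hx
  have hcovariant (g s t : Γ) : c s t = translate g (c (s * g) (t * g)) := by
    have hcomm := hx (rightTranslation ν g) (fun f _ => commute_coeffOp_rightTranslation f g)
      fun h => commute_groupOp_rightTranslation h g
    have hentry := congrArg (fun x => entry x s (t * g)) hcomm.eq
    simp only [entry_rightTranslation_mul, entry_mul_rightTranslation, mul_inv_cancel_right,
      ← hc, koopman_mul_mulOp] at hentry
    exact (eq_of_mulOp_mul_koopman g hentry).symm
  refine ⟨fun g => c 1 g⁻¹, fun g => hcN _ _, fun s t => ?_⟩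
  simp only [← hc, hcovariant s⁻¹ s t, mul_inv_cancel, mul_inv_rev, inv_inv]

end Fourier

/-! ### Pinching onto the diagonal -/

section Pinching

variable {Γ : Type uΓ} [Group Γ] {Y : Type uY} [MeasurableSpace Y] {ν : Measure Y}
  [MulAction Γ Y] [NonsingularAction Γ ν]

theorem norm_coeffOp_le (f : Lp ℂ ∞ ν) : ‖coeffOp Γ f‖ ≤ ‖f‖ :=
  (norm_diagOp_le _).trans_eq (abs_of_nonneg (norm_nonneg f))

/-- The successive averages of `x` over conjugation by `1` and by `coeffOp (u k)`. When the `u k`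
take the values `±1`, each step deletes the part of `x` that anticommutes with `coeffOp (u k)`. -/
def pinching (u : ℕ → Lp ℂ ∞ ν) (x : RegularSpace Γ ν →L[ℂ] RegularSpace Γ ν) :
    ℕ → RegularSpace Γ ν →L[ℂ] RegularSpace Γ ν
  | 0 => x
  | k + 1 => (2⁻¹ : ℂ) • (pinching u x k + coeffOp Γ (u k) * pinching u x k * coeffOp Γ (u k))

theorem half_add_sign_mul (i j : Bool) (a : ℂ) :
    2⁻¹ * (a + (if i then 1 else -1) * a * (if j then 1 else -1)) = if i = j then a else 0 := by
  cases i <;> cases j <;> simp <;> ring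

variable {u : ℕ → Lp ℂ ∞ ν} {x : RegularSpace Γ ν →L[ℂ] RegularSpace Γ ν}

theorem pinching_mem {Q : VonNeumannAlgebra (RegularSpace Γ ν)} (hu : ∀ k, coeffOp Γ (u k) ∈ Q)
    (hx : x ∈ Q) : ∀ k, pinching u x k ∈ Q
  | 0 => hx
  | k + 1 => by
    have hk := pinching_mem hu hx k
    have hsum := add_mem hk (mul_mem (mul_mem (hu k) hk) (hu k))
    simpa only [pinching, smul_mul_assoc, one_mul] using mul_mem (smul_one_mem Q 2⁻¹) hsum

theorem norm_pinching_le (hu : ∀ k, ‖u k‖ ≤ 1) : ∀ k, ‖pinching u x k‖ ≤ ‖x‖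
  | 0 => le_rfl
  | k + 1 => by
    have huk : ‖coeffOp Γ (u k)‖ ≤ 1 := (norm_coeffOp_le _).trans (hu k)
    have hk := norm_pinching_le hu k
    calc ‖pinching u x (k + 1)‖
        ≤ ‖(2⁻¹ : ℂ)‖ * (‖pinching u x k‖ +
            ‖coeffOp Γ (u k)‖ * ‖pinching u x k‖ * ‖coeffOp Γ (u k)‖) := by
          rw [pinching, norm_smul]
          gcongr
          refine (norm_add_le _ _).trans ?_
          gcongr
          exact (norm_mul_le _ _).trans (by gcongr; exact norm_mul_le _ _)
      _ ≤ ‖(2⁻¹ : ℂ)‖ * (‖x‖ + 1 * ‖x‖ * 1) := by gcongr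
      _ = ‖x‖ := by norm_num; ring

variable {b : Y → ℕ → Bool} (hu : ∀ k, u k =ᵐ[ν] fun y => if b y k then 1 else -1)

include hu

theorem exists_entry_pinching {c : Lp ℂ ∞ ν} {s t : Γ} (hc : entry x s t = mulOp c) :
    ∀ k, ∃ c' : Lp ℂ ∞ ν, entry (pinching u x k) s t = mulOp c' ∧
      c' =ᵐ[ν] {y | ∀ j < k, b (s • y) j = b (t • y) j}.indicator c
  | 0 => ⟨c, hc, by simp⟩
  | k + 1 => by
    obtain ⟨c', hentry, hc'⟩ := exists_entry_pinching hc k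
    let us : Lp ℂ ∞ ν := translate s⁻¹ (u k)
    let ut : Lp ℂ ∞ ν := translate t⁻¹ (u k)
    let d : Lp ℂ ∞ ν := us • c'
    let d' : Lp ℂ ∞ ν := d • ut
    refine ⟨(2⁻¹ : ℂ) • (c' + d'), ?_, ?_⟩
    · rw [pinching, entry_smul, entry_add, entry_mul_coeffOp, entry_coeffOp_mul, hentry, mulOp_smul,
        mulOp_add, mulOp_mul, mulOp_mul]
    · filter_upwards [Lp.coeFn_smul (2⁻¹ : ℂ) (c' + d'), Lp.coeFn_add c' d',
        Lp.coeFn_lpSMul (r := ∞) d ut, Lp.coeFn_lpSMul (r := ∞) us c', coeFn_translate s⁻¹ (u k),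
        coeFn_translate t⁻¹ (u k), ae_smul ν s (hu k), ae_smul ν t (hu k), hc']
        with y h₁ h₂ h₃ h₄ h₅ h₆ h₇ h₈ h₉
      rw [inv_inv] at h₅ h₆
      simp only [h₁, Pi.smul_apply, h₂, Pi.add_apply, d', h₃, d, Pi.smul_apply', h₄, us, h₅, ut, h₆,
        h₇, h₈, h₉, smul_eq_mul, Set.indicator_apply, Set.mem_ofPred_eq, Nat.forall_lt_succ_right]
      rw [half_add_sign_mul]
      grind

theorem coeFn_entry_pinching {s t : Γ} (hx : entry x s t ∈ Set.range mulOp) (k : ℕ)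
    (ξ : Lp ℂ 2 ν) : entry (pinching u x k) s t ξ =ᵐ[ν]
      {y | ∀ j < k, b (s • y) j = b (t • y) j}.indicator (entry x s t ξ) := by
  obtain ⟨c, hc⟩ := hx
  obtain ⟨c', hentry, hc'⟩ := exists_entry_pinching hu hc.symm k
  rw [hentry, ← hc]
  filter_upwards [coeFn_mulOp c' ξ, coeFn_mulOp c ξ, hc'] with y h₁ h₂ h₃
  rw [h₁, h₃, Set.indicator_apply, Set.indicator_apply, h₂, ite_mul, zero_mul]

theorem tendsto_entry_pinching {s t : Γ} (hx : entry x s t ∈ Set.range mulOp)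
    (hb : ∀ᵐ y ∂ν, b (s • y) ≠ b (t • y)) (ξ : Lp ℂ 2 ν) :
    Tendsto (fun k => entry (pinching u x k) s t ξ) atTop (𝓝 0) := by
  have hentry := ae_all_iff.2 fun k => coeFn_entry_pinching hu hx k ξ
  refine tendsto_Lp_of_dominated ENNReal.ofNat_ne_top (Lp.memLp (entry x s t ξ)).norm (fun k => ?_)
    ?_
  · filter_upwards [hentry] with y hy
    rw [hy k]
    exact norm_indicator_le_norm_self _ _
  · filter_upwards [hentry, hb, Lp.coeFn_zero ℂ 2 ν] with y hy hne h0
    obtain ⟨j, hj⟩ := Function.ne_iff.1 hne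
    rw [h0]
    refine tendsto_const_nhds.congr' ?_
    filter_upwards [eventually_gt_atTop j] with k hk
    rw [hy k, Pi.zero_apply, Set.indicator_of_notMem]
    exact fun hmem => hj (hmem j hk)

theorem tendsto_pinching (hu' : ∀ k, ‖u k‖ ≤ 1)
    (hb : ∀ s t : Γ, s ≠ t → ∀ᵐ y ∂ν, b (s • y) ≠ b (t • y))
    (hx : ∀ s t, entry x s t ∈ Set.range mulOp)
    {D : RegularSpace Γ ν →L[ℂ] RegularSpace Γ ν} (hdiag : ∀ s, entry D s s = entry x s s)
    (hoff : ∀ s t, s ≠ t → entry D s t = 0) (ξ : RegularSpace Γ ν) :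
    Tendsto (fun k => pinching u x k ξ) atTop (𝓝 (D ξ)) := by
  classical
  refine tendsto_apply_of_tendsto_single (norm_pinching_le hu') (fun t η => ?_) ξ
  refine tendsto_lp_of_dominated ENNReal.ofNat_ne_top (b := x (lp.single 2 t η)) (fun k s => ?_)
    fun s => ?_
  · refine Lp.norm_le_norm_of_ae_le ?_
    filter_upwards [coeFn_entry_pinching hu (hx s t) k η] with y hy
    exact (congrArg norm hy).trans_le (norm_indicator_le_norm_self _ _)
  · change Tendsto (fun k => entry (pinching u x k) s t η) atTop (𝓝 (entry D s t η))
    obtain rfl | hst := eq_or_ne s t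
    · have hconst (k : ℕ) : entry (pinching u x k) s s η = entry x s s η := by
        refine Lp.ext ?_
        filter_upwards [coeFn_entry_pinching hu (hx s s) k η] with y hy
        rw [hy]
        simp
      simp only [hconst, hdiag]
      exact tendsto_const_nhds
    · rw [hoff s t hst]
      exact tendsto_entry_pinching hu (hx s t) (hb s t hst) η

end Pinching

section Expectation

variable {Γ : Type uΓ} [Group Γ] {X : Type uX} {Y : Type uY} [MeasurableSpace X]
  [MeasurableSpace Y] [MulAction Γ X] [MulAction Γ Y] {μ : Measure X} {ν : Measure Y}
  {π : Y → X}

theorem exists_separating_signs (X : Type*) [MeasurableSpace X]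
    [MeasurableSpace.CountablySeparated X] (μ : Measure X) :
    ∃ (b : X → ℕ → Bool) (u : ℕ → Lp ℂ ∞ μ), Function.Injective b ∧ (∀ k, ‖u k‖ ≤ 1) ∧
      ∀ k, u k =ᵐ[μ] fun x => if b x k then 1 else -1 := by
  obtain ⟨b, hbm, hb⟩ := MeasurableSpace.measurable_injection_nat_bool_of_countablySeparated X
  have hmeas (k : ℕ) : Measurable fun x => if b x k then (1 : ℂ) else -1 :=
    (Measurable.of_discrete (f := fun i : Bool => if i then (1 : ℂ) else -1)).comp
      ((measurable_pi_apply k).comp hbm)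
  have hnorm (k : ℕ) (x : X) : ‖if b x k then (1 : ℂ) else -1‖ ≤ 1 := by
    split_ifs <;> simp
  choose u hu using fun k =>
    exists_linfty_ae_eq (ν := μ) (hmeas k).aestronglyMeasurable (.of_forall (hnorm k))
  refine ⟨b, u, hb, fun k => norm_le_of_ae_norm_le zero_le_one ?_, hu⟩
  filter_upwards [hu k] with x hx
  rw [hx]
  exact hnorm k x

theorem ae_smul_ne (hX : EssentiallyFree Γ μ) (hπ : IsFactorMap Γ ν μ π) {s t : Γ} (hst : s ≠ t) :
    ∀ᵐ y ∂ν, π (s • y) ≠ π (t • y) := by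
  have hfree := hX (s⁻¹ * t) (inv_mul_eq_one.not.2 hst)
  filter_upwards [hπ.ae_comp (measure_eq_zero_iff_ae_notMem.1 hfree), hπ.equivariant s,
    hπ.equivariant t] with y hy hs ht h
  exact hy (by rw [mul_smul, ← ht, ← h, hs, inv_smul_smul])

variable [MeasurableSpace.CountablySeparated X] [NonsingularAction Γ ν]
  {Q : VonNeumannAlgebra (RegularSpace Γ ν)} {x : RegularSpace Γ ν →L[ℂ] RegularSpace Γ ν}
  {c : Γ → Lp ℂ ∞ ν}

theorem HasFourierCoeff.coeffOp_one_mem (hc : HasFourierCoeff x c) (hX : EssentiallyFree Γ μ)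
    (hπ : IsFactorMap Γ ν μ π) (hQ : ∀ f, coeffOp Γ (pullback π hπ.quasi f) ∈ Q) (hx : x ∈ Q) :
    coeffOp Γ (c 1) ∈ Q := by
  classical
  obtain ⟨b, u, hb, hu, hub⟩ := exists_separating_signs X μ
  refine mem_of_tendsto_apply (pinching_mem (fun k => hQ (u k)) hx)
    (tendsto_pinching (b := b ∘ π) (fun k => ?_) (fun k => ?_) (fun s t hst => ?_)
      (fun s t => ⟨_, (hc s t).symm⟩) (fun s => ?_) fun s t hst => ?_)
  · exact (coeFn_pullback _ _).trans (hπ.quasi.ae_eq_comp (hub k))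
  · exact (norm_pullback_le _ _ _).trans (hu k)
  · filter_upwards [ae_smul_ne hX hπ hst] with y hy
    exact hb.ne hy
  · rw [hc, mul_inv_cancel, coeffOp, entry_diagOp, if_pos rfl]
  · rw [coeffOp, entry_diagOp, if_neg hst]

theorem HasFourierCoeff.coeffOp_mem (hc : HasFourierCoeff x c) (hX : EssentiallyFree Γ μ)
    (hπ : IsFactorMap Γ ν μ π) (hQ : ∀ f, coeffOp Γ (pullback π hπ.quasi f) ∈ Q)
    (hgroup : ∀ g, groupOp ν g ∈ Q) (hx : x ∈ Q) (g : Γ) : coeffOp Γ (c g) ∈ Q := by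
  simpa using (hc.mul_groupOp g⁻¹).coeffOp_one_mem hX hπ hQ (mul_mem hx (hgroup g⁻¹))

end Expectation

/-! ### Factor maps -/

section Factor

variable {Y : Type*} {Z : Type*} {W : Type*} [MeasurableSpace Y] [MeasurableSpace Z]
  [MeasurableSpace W] {ν : Measure Y} {ζ : Measure Z} {ω : Measure W} {p : Y → Z}

theorem pullback_pullback {q : Z → W} {r : Y → W} (hp : QuasiMeasurePreserving p ν ζ)
    (hq : QuasiMeasurePreserving q ζ ω) (hr : QuasiMeasurePreserving r ν ω) (h : q ∘ p =ᵐ[ν] r)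
    (f : Lp ℂ ∞ ω) : pullback p hp (pullback q hq f) = pullback r hr f := by
  refine pullback_eq_of_ae_eq hp (coeFn_pullback hq f) ?_
  filter_upwards [coeFn_pullback hr f, h] with y hf hy
  rw [hf, Function.comp_apply, ← hy, Function.comp_apply, Function.comp_apply, Function.comp_apply]

namespace IsFactorMap

variable {Γ : Type uΓ} [Group Γ] [MulAction Γ Y] [MulAction Γ Z] [MulAction Γ W]

theorem ae_of_ae_comp (hp : IsFactorMap Γ ν ζ p) {P : Z → Prop} (hP : MeasurableSet {z | P z})
    (h : ∀ᵐ y ∂ν, P (p y)) : ∀ᵐ z ∂ζ, P z :=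
  hp.absolutelyContinuous.ae_le ((ae_map_iff hp.quasi.aemeasurable hP).2 h)

theorem range_pullback (hp : IsFactorMap Γ ν ζ p) :
    Set.range (pullback p hp.quasi) =
      {f : Lp ℂ ∞ ν | AEStronglyMeasurable[MeasurableSpace.comap p inferInstance] f ν} := by
  refine Set.Subset.antisymm ?_ ?_
  · rintro _ ⟨g, rfl⟩
    exact ⟨g ∘ p, (Lp.stronglyMeasurable g).comp_measurable (comap_measurable p),
      coeFn_pullback hp.quasi g⟩
  · rintro f ⟨G, hG, hfG⟩
    obtain ⟨g, hg, rfl⟩ := hG.exists_eq_measurable_comp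
    have hbound : ∀ᵐ z ∂ζ, ‖g z‖ ≤ ‖f‖ := by
      refine hp.ae_of_ae_comp (measurableSet_le hg.measurable.norm measurable_const) ?_
      filter_upwards [hfG, ae_norm_le_norm f] with y hy hfy
      rwa [hy] at hfy
    obtain ⟨g', hg'⟩ := exists_linfty_ae_eq hg.aestronglyMeasurable hbound
    exact ⟨g', pullback_eq_of_ae_eq hp.quasi hg' hfG⟩

theorem isSeqClosedAlgebra_range [IsFiniteMeasure ν] (hp : IsFactorMap Γ ν ζ p) :
    IsSeqClosedAlgebra (Set.range (pullback p hp.quasi)) :=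
  hp.range_pullback ▸ isSeqClosedAlgebra_setOf_aestronglyMeasurable _

theorem translate_pullback [NonsingularAction Γ ν] [NonsingularAction Γ ζ]
    (hp : IsFactorMap Γ ν ζ p) (s : Γ) (f : Lp ℂ ∞ ζ) :
    translate s (pullback p hp.quasi f) = pullback p hp.quasi (translate s f) := by
  have hs := NonsingularAction.quasi (μ := ν) s⁻¹
  rw [translate, translate, pullback_pullback hs hp.quasi (hp.quasi.comp hs) .rfl]
  refine (pullback_pullback hp.quasi _ _ ?_ f).symm
  filter_upwards [hp.equivariant s⁻¹] with y hy
  exact hy.symm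

theorem of_comp [MeasurableEq W] [NonsingularAction Γ ν] [NonsingularAction Γ ζ]
    [NonsingularAction Γ ω] {h : Z → W} {p' : Y → W} (hp : IsFactorMap Γ ν ζ p)
    (hp' : IsFactorMap Γ ν ω p') (hh : Measurable h) (hcomp : h ∘ p =ᵐ[ν] p') :
    IsFactorMap Γ ζ ω h := by
  have hmap : (ν.map p).map h = ν.map p' := by
    rw [Measure.map_map hh hp.quasi.measurable, Measure.map_congr hcomp]
  refine ⟨⟨hh, ?_⟩, ?_, fun s => ?_⟩
  · exact (hmap ▸ hp.absolutelyContinuous.map hh).trans hp'.quasi.absolutelyContinuous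
  · exact hp'.absolutelyContinuous.trans (hmap ▸ hp.quasi.absolutelyContinuous.map hh)
  · refine hp.ae_of_ae_comp (measurableSet_eq_fun
      (hh.comp (NonsingularAction.quasi (μ := ζ) s).measurable)
      ((NonsingularAction.quasi (μ := ω) s).measurable.comp hh)) ?_
    filter_upwards [hcomp, ae_smul ν s hcomp, hp.equivariant s, hp'.equivariant s]
      with y hy hsy hp hp'
    rw [← hp, ← Function.comp_apply (f := h), ← Function.comp_apply (f := h), hy, hsy, hp']

end IsFactorMap

theorem exists_measurableEmbedding_complex (W : Type*) [MeasurableSpace W]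
    [StandardBorelSpace W] : ∃ e : W → ℂ, MeasurableEmbedding e ∧ ∀ w, ‖e w‖ ≤ 1 := by
  refine ⟨fun w => ((unitInterval.sigmoid (embeddingReal W w) : ℝ) : ℂ),
    Complex.isometry_ofReal.isClosedEmbedding.measurableEmbedding.comp
      ((MeasurableEmbedding.subtype_coe measurableSet_Icc).comp
        (measurableEmbedding_sigmoid_comp_embeddingReal W)), fun w => ?_⟩
  rw [Complex.norm_real, Real.norm_of_nonneg (unitInterval.nonneg _)]
  exact unitInterval.le_one _

/-- The factoring map is read off from a bounded function that separates the points of `W`. -/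
theorem IsFactorMap.exists_comp_eq {Γ : Type uΓ} [Group Γ] [MulAction Γ Y] [MulAction Γ Z]
    [MulAction Γ W] [StandardBorelSpace W] [Nonempty W] [NonsingularAction Γ ν]
    [NonsingularAction Γ ζ] [NonsingularAction Γ ω] {p' : Y → W} (hp : IsFactorMap Γ ν ζ p)
    (hp' : IsFactorMap Γ ν ω p')
    (hle : Set.range (pullback p' hp'.quasi) ⊆ Set.range (pullback p hp.quasi)) :
    ∃ h : Z → W, IsFactorMap Γ ζ ω h ∧ h ∘ p =ᵐ[ν] p' := by
  obtain ⟨e, he, hbound⟩ := exists_measurableEmbedding_complex W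
  obtain ⟨f, hf⟩ :=
    exists_linfty_ae_eq (ν := ω) he.measurable.aestronglyMeasurable (.of_forall hbound)
  obtain ⟨g, hg⟩ := hle ⟨f, rfl⟩
  obtain ⟨r, hr, hre⟩ := he.exists_measurable_extend measurable_id fun _ => inferInstance
  have hcomp : (r ∘ g) ∘ p =ᵐ[ν] p' := by
    filter_upwards [coeFn_pullback hp.quasi g, coeFn_pullback hp'.quasi f, hp'.ae_comp hf]
      with y hgy hfy hey
    rw [hg, hfy, Function.comp_apply, hey] at hgy
    change r ((g ∘ p) y) = p' y
    rw [← hgy]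
    exact congrFun hre (p' y)
  exact ⟨r ∘ g, hp.of_comp hp' (hr.comp (Lp.stronglyMeasurable g).measurable) hcomp, hcomp⟩

end Factor

/-! ### Intermediate extensions and intermediate algebras -/

section Extensions

variable {Γ : Type uΓ} [Group Γ] {X : Type uX} {Y : Type uY}
  [MeasurableSpace X] [MeasurableSpace Y] [MulAction Γ Y] {μ : Measure X} {ν : Measure Y}
  {π : Y → X}

theorem IsSeqClosedAlgebra.exists_seq_generating [IsFiniteMeasure ν]
    [MeasurableSpace.CountablyGenerated Y] {N : Set (Lp ℂ ∞ ν)} (hN : IsSeqClosedAlgebra N) :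
    ∃ f : ℕ → Lp ℂ ∞ ν, (∀ n, f n ∈ N) ∧
      ∀ M : Set (Lp ℂ ∞ ν), IsSeqClosedAlgebra M → (∀ n, f n ∈ M) → N ⊆ M := by
  have : Fact ((2 : ℝ≥0∞) ≠ ∞) := ⟨ENNReal.ofNat_ne_top⟩
  obtain ⟨t, htN, htc, htd⟩ := (TopologicalSpace.IsSeparable.of_separableSpace
    ((fun g => mulOp g (oneL2 ν)) '' N)).exists_countable_dense_subset
  have hne : t.Nonempty := closure_nonempty_iff.1 ⟨_, htd ⟨_, hN.const_mem 1, rfl⟩⟩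
  obtain ⟨u, rfl⟩ := htc.exists_eq_range hne
  choose f hfN hfu using fun n => htN ⟨n, rfl⟩
  refine ⟨f, hfN, fun M hM hfM g hg => hM.mem_of_mem_closure (closure_mono ?_ (htd ⟨g, hg, rfl⟩))⟩
  rintro _ ⟨n, rfl⟩
  exact ⟨f n, hfM n, hfu n⟩

namespace IntermediateAlgebra

variable [NonsingularAction Γ ν] [IsFiniteMeasure ν] {hπ : QuasiMeasurePreserving π ν μ}
  (N : IntermediateAlgebra Γ μ ν π hπ)

theorem isSeqClosedAlgebra : IsSeqClosedAlgebra N.carrier :=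
  isSeqClosedAlgebra_iff.2 N.isVonNeumann

theorem measurable_sigmaAlgebra_base : Measurable[N.isSeqClosedAlgebra.sigmaAlgebra] π :=
  fun _ hB => ⟨_, N.base_mem ⟨setIndicator hB, rfl⟩,
    (coeFn_pullback hπ _).trans (hπ.ae_eq_comp (coeFn_setIndicator hB))⟩

theorem measurable_sigmaAlgebra_smul (s : Γ) :
    Measurable[N.isSeqClosedAlgebra.sigmaAlgebra, N.isSeqClosedAlgebra.sigmaAlgebra]
      fun y : Y => s • y := by
  rintro B ⟨f, hf, hfB⟩
  refine ⟨translate s⁻¹ f, N.translate_mem s⁻¹ f hf, ?_⟩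
  filter_upwards [coeFn_translate s⁻¹ f, ae_smul ν s hfB] with y hy hBy
  rw [hy, inv_inv, hBy]
  rfl

end IntermediateAlgebra

namespace IntermediateExtension

variable [MulAction Γ X]

theorem linfty_subset_of_equivalent {E E' : IntermediateExtension.{uΓ, uX, uY, w} Γ μ ν π}
    (h : Equivalent E E') : E'.linfty ⊆ E.linfty := by
  obtain ⟨h, k, hh, -, -, -, hp, -⟩ := h
  rintro _ ⟨f, rfl⟩
  exact ⟨pullback h hh.quasi f, pullback_pullback _ _ _ hp f⟩

variable [NonsingularAction Γ ν]

/-- The intermediate algebra `L^∞(Z)` of an intermediate extension. -/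
def toAlgebra [IsFiniteMeasure ν] (hπ : QuasiMeasurePreserving π ν μ)
    (E : IntermediateExtension.{uΓ, uX, uY, w} Γ μ ν π) : IntermediateAlgebra Γ μ ν π hπ where
  carrier := E.linfty
  isVonNeumann := isSeqClosedAlgebra_iff.1 E.isFactorMap_p.isSeqClosedAlgebra_range
  translate_mem := by
    rintro s _ ⟨f, rfl⟩
    exact ⟨translate s f, (E.isFactorMap_p.translate_pullback s f).symm⟩
  base_mem := by
    rintro _ ⟨f, rfl⟩
    exact ⟨pullback E.q E.isFactorMap_q.quasi f, pullback_pullback _ _ _ E.comp_eq f⟩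

theorem equivalent_of_linfty_eq [MeasurableEq X]
    {E E' : IntermediateExtension.{uΓ, uX, uY, w} Γ μ ν π} (h : E.linfty = E'.linfty) :
    Equivalent E E' := by
  have : Nonempty E.Z := nonempty_of_isProbabilityMeasure E.ζ
  have : Nonempty E'.Z := nonempty_of_isProbabilityMeasure E'.ζ
  obtain ⟨a, ha, hap⟩ := E.isFactorMap_p.exists_comp_eq E'.isFactorMap_p h.ge
  obtain ⟨b, hb, hbp⟩ := E'.isFactorMap_p.exists_comp_eq E.isFactorMap_p h.le
  have ham := ha.quasi.measurable
  have hbm := hb.quasi.measurable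
  refine ⟨a, b, ha, hb, ?_, ?_, hap, ?_⟩
  · refine E.isFactorMap_p.ae_of_ae_comp (measurableSet_eq_fun (hbm.comp ham) measurable_id') ?_
    filter_upwards [hap, hbp] with y hay hby
    rw [← Function.comp_apply (f := a), hay, ← Function.comp_apply (f := b), hby]
  · refine E'.isFactorMap_p.ae_of_ae_comp (measurableSet_eq_fun (ham.comp hbm) measurable_id') ?_
    filter_upwards [hap, hbp] with y hay hby
    rw [← Function.comp_apply (f := b), hby, ← Function.comp_apply (f := a), hay]
  · refine E.isFactorMap_p.ae_of_ae_comp (measurableSet_eq_fun E.isFactorMap_q.quasi.measurable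
      (E'.isFactorMap_q.quasi.measurable.comp ham)) ?_
    filter_upwards [hap, E.comp_eq, E'.comp_eq] with y hay hqy hqy'
    simp only [Function.comp_apply] at hay hqy hqy'
    rw [hay, hqy, hqy']

end IntermediateExtension

end Extensions

/-! ### Realization of intermediate algebras -/

section Realization

variable {Γ : Type uΓ} [Group Γ]

/-- The product `W^Γ`, on which `Γ` acts by left translation of the coordinates. -/
def Shift (Γ : Type uΓ) (W : Type uZ) : Type (max uΓ uZ) := Γ → W

namespace Shift

variable {W : Type uZ}

instance [MeasurableSpace W] : MeasurableSpace (Shift Γ W) :=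
  inferInstanceAs (MeasurableSpace (Γ → W))

instance [Countable Γ] [MeasurableSpace W] [StandardBorelSpace W] :
    StandardBorelSpace (Shift Γ W) :=
  inferInstanceAs (StandardBorelSpace (Γ → W))

instance : MulAction Γ (Shift Γ W) where
  smul s z := fun t => z (s⁻¹ * t)
  one_smul z := by
    funext t
    change z (1⁻¹ * t) = z t
    rw [inv_one, one_mul]
  mul_smul s s' z := by
    funext t
    change z ((s * s')⁻¹ * t) = z (s'⁻¹ * (s⁻¹ * t))
    rw [mul_inv_rev, mul_assoc]

theorem measurable_smul [MeasurableSpace W] (s : Γ) : Measurable fun z : Shift Γ W => s • z :=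
  measurable_pi_lambda _ fun t => measurable_pi_apply (s⁻¹ * t)

variable {Y : Type uY} [MulAction Γ Y]

/-- The equivariant map into `W^Γ` that records the values of `w` along orbits. -/
def coding (Γ : Type uΓ) [Group Γ] [MulAction Γ Y] (w : Y → W) (y : Y) : Shift Γ W :=
  fun s => w (s⁻¹ • y)

theorem coding_smul (w : Y → W) (s : Γ) (y : Y) : coding Γ w (s • y) = s • coding Γ w y := by
  funext t
  change w (t⁻¹ • s • y) = w ((s⁻¹ * t)⁻¹ • y)
  rw [mul_inv_rev, inv_inv, mul_smul]

theorem coding_apply_one (w : Y → W) (y : Y) : coding Γ w y 1 = w y := by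
  rw [coding, inv_one, one_smul]

theorem measurable_coding [MeasurableSpace W] {_ : MeasurableSpace Y} {w : Y → W}
    (hsmul : ∀ s : Γ, Measurable fun y : Y => s • y) (hw : Measurable w) :
    Measurable (coding Γ w) :=
  measurable_pi_lambda _ fun s => hw.comp (hsmul s⁻¹)

end Shift

theorem exists_measurableEquiv_standardBorel (Z : Type uZ) [MeasurableSpace Z]
    [StandardBorelSpace Z] :
    ∃ (Z' : Type w) (_ : MeasurableSpace Z') (_ : Z ≃ᵐ Z'), StandardBorelSpace Z' := by
  have he : MeasurableEmbedding (ULift.up.{w} ∘ embeddingReal Z) :=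
    MeasurableEquiv.ulift.symm.measurableEmbedding.comp (measurableEmbedding_embeddingReal Z)
  exact ⟨_, _, he.equivRange, he.measurableSet_range.standardBorel⟩

variable {X : Type uX} {Y : Type uY} [MeasurableSpace X] [MeasurableSpace Y] [MulAction Γ X]
  [MulAction Γ Y] {μ : Measure X} {ν : Measure Y} [NonsingularAction Γ ν] {π : Y → X}

theorem nonsingularAction_map {Z : Type*} [MeasurableSpace Z] [MulAction Γ Z]
    (hsmul : ∀ s : Γ, Measurable fun z : Z => s • z) {p : Y → Z} (hp : Measurable p)
    (hequiv : ∀ (s : Γ) y, p (s • y) = s • p y) : NonsingularAction Γ (ν.map p) where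
  quasi s := by
    have hs := NonsingularAction.quasi (μ := ν) s
    refine ⟨hsmul s, ?_⟩
    rw [Measure.map_map (hsmul s) hp, ← (funext (hequiv s) : p ∘ (s • ·) = (s • ·) ∘ p),
      ← Measure.map_map hp hs.measurable]
    exact hs.absolutelyContinuous.map hp

namespace IntermediateExtension

variable [MeasurableEq X] [IsProbabilityMeasure ν] [NonsingularAction Γ μ]

theorem exists_of_equivariant (hπ : IsFactorMap Γ ν μ π) {Z : Type w} [MeasurableSpace Z]
    [StandardBorelSpace Z] [MulAction Γ Z] (hsmul : ∀ s : Γ, Measurable fun z : Z => s • z)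
    {p : Y → Z} {q : Z → X} (hp : Measurable p) (hq : Measurable q)
    (hequiv : ∀ (s : Γ) y, p (s • y) = s • p y) (hqp : q ∘ p = π) :
    ∃ E : IntermediateExtension.{uΓ, uX, uY, w} Γ μ ν π, E.linfty =
      {f : Lp ℂ ∞ ν | AEStronglyMeasurable[MeasurableSpace.comap p inferInstance] f ν} := by
  have := Measure.isProbabilityMeasure_map (μ := ν) hp.aemeasurable
  have := nonsingularAction_map (ν := ν) hsmul hp hequiv
  have hpf : IsFactorMap Γ ν (ν.map p) p :=
    ⟨⟨hp, .rfl⟩, .rfl, fun s => .of_forall (hequiv s)⟩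
  have hqp' : q ∘ p =ᵐ[ν] π := .of_forall (congrFun hqp)
  exact ⟨⟨Z, ν.map p, p, q, hpf, hpf.of_comp hπ hq hqp', hqp'⟩, hpf.range_pullback⟩

theorem exists_of_equivariant_ulift (hπ : IsFactorMap Γ ν μ π) {Z : Type uZ} [MeasurableSpace Z]
    [StandardBorelSpace Z] [MulAction Γ Z] (hsmul : ∀ s : Γ, Measurable fun z : Z => s • z)
    {p : Y → Z} {q : Z → X} (hp : Measurable p) (hq : Measurable q)
    (hequiv : ∀ (s : Γ) y, p (s • y) = s • p y) (hqp : q ∘ p = π) :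
    ∃ E : IntermediateExtension.{uΓ, uX, uY, w} Γ μ ν π, E.linfty =
      {f : Lp ℂ ∞ ν | AEStronglyMeasurable[MeasurableSpace.comap p inferInstance] f ν} := by
  obtain ⟨Z', _, e, _⟩ := exists_measurableEquiv_standardBorel.{uZ, w} Z
  let _ : MulAction Γ Z' := e.symm.toEquiv.mulAction Γ
  obtain ⟨E, hE⟩ := exists_of_equivariant (Z := Z') (p := e ∘ p) (q := q ∘ e.symm) hπ
    (fun s => e.measurable.comp ((hsmul s).comp e.symm.measurable)) (e.measurable.comp hp)
    (hq.comp e.symm.measurable)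
    (fun s y => by
      change e (p (s • y)) = e (s • e.symm (e (p y)))
      rw [hequiv, e.symm_apply_apply])
    (by rw [← hqp, Function.comp_assoc, ← Function.comp_assoc e.symm, e.symm_comp_self,
      Function.id_comp])
  refine ⟨E, ?_⟩
  rw [hE, ← MeasurableSpace.comap_comp, e.measurableEmbedding.comap_eq]

end IntermediateExtension

theorem IntermediateExtension.exists_linfty_eq_carrier [Countable Γ] [StandardBorelSpace X]
    [MeasurableSpace.CountablyGenerated Y] [IsProbabilityMeasure ν] [NonsingularAction Γ μ]
    (hπ : IsFactorMap Γ ν μ π) (N : IntermediateAlgebra Γ μ ν π hπ.quasi) :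
    ∃ E : IntermediateExtension.{uΓ, uX, uY, w} Γ μ ν π, E.linfty = N.carrier := by
  have hN := N.isSeqClosedAlgebra
  obtain ⟨f, hfN, hf⟩ := hN.exists_seq_generating
  set w : Y → (ℕ → ℂ) × X := fun y => (fun n => f n y, π y)
  have hw {m : MeasurableSpace Y} (hfm : ∀ n, Measurable[m] (f n)) (hπm : Measurable[m] π) :
      Measurable[m] w :=
    (measurable_pi_lambda _ hfm).prodMk hπm
  have hp : Measurable (Shift.coding Γ w) :=
    Shift.measurable_coding (fun s => (NonsingularAction.quasi (μ := ν) s).measurable)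
      (hw (fun n => (Lp.stronglyMeasurable (f n)).measurable) hπ.quasi.measurable)
  have hpN : Measurable[hN.sigmaAlgebra] (Shift.coding Γ w) :=
    Shift.measurable_coding N.measurable_sigmaAlgebra_smul
      (hw (fun n => hN.measurable_sigmaAlgebra (hfN n)) N.measurable_sigmaAlgebra_base)
  obtain ⟨E, hE⟩ := exists_of_equivariant_ulift.{uΓ, uX, uY, _, w} hπ Shift.measurable_smul hp
    (measurable_snd.comp (measurable_pi_apply (1 : Γ))) (Shift.coding_smul w)
    (funext fun y => congrArg Prod.snd (Shift.coding_apply_one w y))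
  refine ⟨E, hE.trans (Set.Subset.antisymm (fun g hg => ?_)
    (hf _ (isSeqClosedAlgebra_setOf_aestronglyMeasurable _) fun n => ?_))⟩
  · exact hN.mem_of_aestronglyMeasurable (hg.mono hpN.comap_le)
  · have heval : Measurable fun z : Shift Γ ((ℕ → ℂ) × X) => (z 1).1 n :=
      (measurable_pi_apply n).comp (measurable_fst.comp (measurable_pi_apply (1 : Γ)))
    refine ⟨_, (heval.comp (comap_measurable (Shift.coding Γ w))).stronglyMeasurable, ?_⟩
    exact .of_forall fun y => (congrArg (fun v => v.1 n) (Shift.coding_apply_one w y)).symm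

end Realization

/-! ### The lattice isomorphism -/

section CrossedProduct

variable {Γ : Type uΓ} [Group Γ] {Y : Type uY} [MeasurableSpace Y] [MulAction Γ Y]
  {ν : Measure Y} [NonsingularAction Γ ν]

theorem crossedProduct_mono {N N' : Set (Lp ℂ ∞ ν)} (h : N ⊆ N') :
    crossedProduct Γ N ≤ crossedProduct Γ N' :=
  generated_mono (Set.union_subset_union_left _ (Set.image_mono h))

theorem coeffOp_mem_crossedProduct {N : Set (Lp ℂ ∞ ν)} {f : Lp ℂ ∞ ν} (hf : f ∈ N) :
    coeffOp Γ f ∈ crossedProduct Γ N :=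
  subset_generated _ (.inl ⟨f, hf, rfl⟩)

theorem groupOp_mem_crossedProduct (N : Set (Lp ℂ ∞ ν)) (g : Γ) :
    groupOp ν g ∈ crossedProduct Γ N :=
  subset_generated _ (.inr ⟨g, rfl⟩)

theorem coeffOp_translate (s : Γ) (f : Lp ℂ ∞ ν) :
    coeffOp Γ (translate s f) = groupOp ν s * coeffOp Γ f * groupOp ν s⁻¹ := by
  have hunit : groupOp ν s * groupOp ν s⁻¹ = 1 := by
    ext1 ξ
    ext t : 2
    change ξ (s⁻¹⁻¹ * (s⁻¹ * t)) = ξ t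
    rw [inv_inv, mul_inv_cancel_left]
  rw [groupOp_mul_coeffOp, mul_assoc, hunit, mul_one]

theorem HasFourierCoeff.unique [IsFiniteMeasure ν]
    {x : RegularSpace Γ ν →L[ℂ] RegularSpace Γ ν} {c c' : Γ → Lp ℂ ∞ ν}
    (hc : HasFourierCoeff x c) (hc' : HasFourierCoeff x c') : c = c' := by
  funext g
  have h := (hc 1 g⁻¹).symm.trans (hc' 1 g⁻¹)
  simp only [inv_one, translate_one, one_mul, inv_inv] at h
  exact mulOp_injective h

end CrossedProduct

section Lattice

variable {Γ : Type uΓ} [Group Γ] {X : Type uX} {Y : Type uY} [MeasurableSpace X]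
  [MeasurableSpace Y] [MulAction Γ Y] {μ : Measure X} {ν : Measure Y} [IsFiniteMeasure ν]
  [NonsingularAction Γ ν] {π : Y → X}

namespace IntermediateAlgebra

variable {hπ : QuasiMeasurePreserving π ν μ}

theorem mem_crossedProduct_iff (N : IntermediateAlgebra Γ μ ν π hπ)
    {x : RegularSpace Γ ν →L[ℂ] RegularSpace Γ ν} :
    x ∈ crossedProduct Γ N.carrier ↔
      ∃ c : Γ → Lp ℂ ∞ ν, (∀ g, c g ∈ N.carrier) ∧ HasFourierCoeff x c :=
  ⟨exists_hasFourierCoeff N.isSeqClosedAlgebra N.translate_mem, fun ⟨_, hc, hx⟩ =>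
    hx.mem_crossedProduct (fun _ => N.isSeqClosedAlgebra.star_mem) hc⟩

theorem coeffOp_mem_crossedProduct_iff (N : IntermediateAlgebra Γ μ ν π hπ) {f : Lp ℂ ∞ ν} :
    coeffOp Γ f ∈ crossedProduct Γ N.carrier ↔ f ∈ N.carrier := by
  classical
  refine ⟨fun h => ?_, coeffOp_mem_crossedProduct⟩
  obtain ⟨c, hcN, hc⟩ := N.mem_crossedProduct_iff.1 h
  have hdiag : mulOp (translate (1 : Γ)⁻¹ f) = mulOp (translate (1 : Γ)⁻¹ (c (1 * 1⁻¹))) := by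
    rw [← hc, coeffOp, entry_diagOp, if_pos rfl]
  rw [inv_one, translate_one, translate_one] at hdiag
  exact mulOp_injective hdiag ▸ hcN _

theorem crossedProduct_le_iff {N N' : IntermediateAlgebra Γ μ ν π hπ} :
    crossedProduct Γ N.carrier ≤ crossedProduct Γ N'.carrier ↔ N ≤ N' :=
  ⟨fun h _ hf => N'.coeffOp_mem_crossedProduct_iff.1 (h (coeffOp_mem_crossedProduct hf)),
    fun h => crossedProduct_mono h⟩

/-- The intersection of two intermediate algebras, their meet. -/
def inter (N N' : IntermediateAlgebra Γ μ ν π hπ) : IntermediateAlgebra Γ μ ν π hπ where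
  carrier := N.carrier ∩ N'.carrier
  isVonNeumann := isSeqClosedAlgebra_iff.1 (N.isSeqClosedAlgebra.inter N'.isSeqClosedAlgebra)
  translate_mem s f hf := ⟨N.translate_mem s f hf.1, N'.translate_mem s f hf.2⟩
  base_mem := Set.subset_inter N.base_mem N'.base_mem

theorem mem_crossedProduct_inter_iff (N N' : IntermediateAlgebra Γ μ ν π hπ)
    {x : RegularSpace Γ ν →L[ℂ] RegularSpace Γ ν} :
    x ∈ crossedProduct Γ (N.inter N').carrier ↔
      x ∈ crossedProduct Γ N.carrier ∧ x ∈ crossedProduct Γ N'.carrier := by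
  refine ⟨fun h => ⟨crossedProduct_mono Set.inter_subset_left h,
    crossedProduct_mono Set.inter_subset_right h⟩, ?_⟩
  simp only [mem_crossedProduct_iff]
  rintro ⟨⟨c, hcN, hc⟩, c', hcN', hc'⟩
  obtain rfl := hc.unique hc'
  exact ⟨c, fun g => ⟨hcN g, hcN' g⟩, hc⟩

/-- The von Neumann algebra generated by two intermediate algebras, their join. -/
def join (N N' : IntermediateAlgebra Γ μ ν π hπ) : IntermediateAlgebra Γ μ ν π hπ where
  carrier := mulOp ⁻¹' (generated (mulOp '' N.carrier ∪ mulOp '' N'.carrier))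
  isVonNeumann := isSeqClosedAlgebra_iff.1 (isNormalRep_mulOp.isSeqClosedAlgebra_preimage _)
  translate_mem s f hf := by
    set A := generated (mulOp '' N.carrier ∪ mulOp '' N'.carrier)
    have hclosed : IsSeqClosedAlgebra {f : Lp ℂ ∞ ν | mulOp (translate s f) ∈ A} :=
      (isNormalRep_mulOp.comp_pullback (NonsingularAction.quasi s⁻¹)).isSeqClosedAlgebra_preimage A
    have hle : A ≤ generated (mulOp '' {f : Lp ℂ ∞ ν | mulOp (translate s f) ∈ A}) :=
      generated_mono (Set.union_subset
        (Set.image_mono fun g hg => subset_generated _ (.inl ⟨_, N.translate_mem s g hg, rfl⟩))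
        (Set.image_mono fun g hg => subset_generated _ (.inr ⟨_, N'.translate_mem s g hg, rfl⟩)))
    have hmem := hle hf
    rwa [← SetLike.mem_coe, hclosed.coe_generated, mulOp_injective.mem_set_image] at hmem
  base_mem _ hf := subset_generated _ (.inl ⟨_, N.base_mem hf, rfl⟩)

theorem image_join (N N' : IntermediateAlgebra Γ μ ν π hπ) :
    mulOp '' (N.join N').carrier = generated (mulOp '' N.carrier ∪ mulOp '' N'.carrier) := by
  refine Set.image_preimage_eq_of_subset ?_
  rw [← Set.image_univ, ← isSeqClosedAlgebra_univ.coe_generated]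
  exact generated_mono (Set.union_subset (Set.image_mono (Set.subset_univ _))
    (Set.image_mono (Set.subset_univ _)))

theorem le_join_left (N N' : IntermediateAlgebra Γ μ ν π hπ) : N ≤ N.join N' :=
  fun f hf => subset_generated _ (.inl ⟨f, hf, rfl⟩)

theorem le_join_right (N N' : IntermediateAlgebra Γ μ ν π hπ) : N' ≤ N.join N' :=
  fun f hf => subset_generated _ (.inr ⟨f, hf, rfl⟩)

theorem join_le {N N' M : IntermediateAlgebra Γ μ ν π hπ} (hN : N ≤ M) (hN' : N' ≤ M) :
    N.join N' ≤ M := by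
  intro f hf
  have hmem := generated_mono (Set.union_subset (Set.image_mono hN) (Set.image_mono hN')) hf
  rwa [← SetLike.mem_coe, M.isSeqClosedAlgebra.coe_generated,
    mulOp_injective.mem_set_image] at hmem

/-- The intermediate algebra `Q ∩ L^∞(Y)` of an algebra `Q ⊇ L^∞(X) ⋊ Γ`, with `L^∞(Y)` embedded
by `coeffOp`. -/
def ofCrossed (Q : VonNeumannAlgebra (RegularSpace Γ ν))
    (hQ : crossedProduct Γ (Set.range (pullback π hπ)) ≤ Q) : IntermediateAlgebra Γ μ ν π hπ where
  carrier := coeffOp Γ ⁻¹' Q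
  isVonNeumann := isSeqClosedAlgebra_iff.1 (isNormalRep_coeffOp.isSeqClosedAlgebra_preimage Q)
  translate_mem s f hf := by
    rw [Set.mem_preimage, coeffOp_translate]
    exact mul_mem (mul_mem (hQ (groupOp_mem_crossedProduct _ s)) hf)
      (hQ (groupOp_mem_crossedProduct _ s⁻¹))
  base_mem _ hf := hQ (coeffOp_mem_crossedProduct hf)

theorem crossedProduct_ofCrossed_le (Q : VonNeumannAlgebra (RegularSpace Γ ν))
    (hQ : crossedProduct Γ (Set.range (pullback π hπ)) ≤ Q) :
    crossedProduct Γ (ofCrossed Q hQ).carrier ≤ Q :=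
  generated_le_iff.2 <| Set.union_subset (Set.image_subset_iff.2 fun _ hf => hf)
    (Set.range_subset_iff.2 fun g => hQ (groupOp_mem_crossedProduct _ g))

theorem crossedProduct_join (N N' : IntermediateAlgebra Γ μ ν π hπ) :
    crossedProduct Γ (N.join N').carrier =
      generated ({T | T ∈ crossedProduct Γ N.carrier} ∪
        {T | T ∈ crossedProduct Γ N'.carrier}) := by
  set Q := generated
    ({T | T ∈ crossedProduct Γ N.carrier} ∪ {T | T ∈ crossedProduct Γ N'.carrier})
  have hN : crossedProduct Γ N.carrier ≤ Q := fun _ hT => subset_generated _ (.inl hT)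
  have hN' : crossedProduct Γ N'.carrier ≤ Q := fun _ hT => subset_generated _ (.inr hT)
  have hQ := (crossedProduct_mono N.base_mem).trans hN
  have hjoin : N.join N' ≤ ofCrossed Q hQ :=
    join_le (fun _ hf => hN (coeffOp_mem_crossedProduct hf))
      fun _ hf => hN' (coeffOp_mem_crossedProduct hf)
  exact le_antisymm ((crossedProduct_mono hjoin).trans (crossedProduct_ofCrossed_le Q hQ))
    (generated_le_iff.2 (Set.union_subset (crossedProduct_mono (N.le_join_left N'))
      (crossedProduct_mono (N.le_join_right N'))))

end IntermediateAlgebra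

variable [MulAction Γ X] [MeasurableSpace.CountablySeparated X]

theorem crossedProduct_ofCrossed (hX : EssentiallyFree Γ μ) (hπ : IsFactorMap Γ ν μ π)
    (Q : VonNeumannAlgebra (RegularSpace Γ ν))
    (hQ : crossedProduct Γ (Set.range (pullback π hπ.quasi)) ≤ Q)
    (hQ' : Q ≤ crossedProduct Γ (Set.univ : Set (Lp ℂ ∞ ν))) :
    crossedProduct Γ (IntermediateAlgebra.ofCrossed Q hQ).carrier = Q := by
  refine le_antisymm (IntermediateAlgebra.crossedProduct_ofCrossed_le Q hQ) fun x hx => ?_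
  obtain ⟨c, -, hc⟩ := exists_hasFourierCoeff isSeqClosedAlgebra_univ
    (fun _ _ _ => trivial) (hQ' hx)
  exact (IntermediateAlgebra.mem_crossedProduct_iff _).2 ⟨c, hc.coeffOp_mem hX hπ
    (fun f => hQ (coeffOp_mem_crossedProduct ⟨f, rfl⟩))
    (fun g => hQ (groupOp_mem_crossedProduct _ g)) hx, hc⟩

/-- The order isomorphism `N ↦ N ⋊ Γ`, with inverse `Q ↦ Q ∩ L^∞(Y)`. -/
def crossedProductOrderIso (hX : EssentiallyFree Γ μ) (hπ : IsFactorMap Γ ν μ π) :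
    IntermediateAlgebra Γ μ ν π hπ.quasi ≃o
      Set.Icc (crossedProduct Γ (Set.range (pullback π hπ.quasi)))
        (crossedProduct Γ (Set.univ : Set (Lp ℂ ∞ ν))) where
  toFun N := ⟨crossedProduct Γ N.carrier, crossedProduct_mono N.base_mem,
    crossedProduct_mono (Set.subset_univ _)⟩
  invFun Q := .ofCrossed Q.1 Q.2.1
  left_inv N := IntermediateAlgebra.ext (Set.ext fun _ => N.coeffOp_mem_crossedProduct_iff)
  right_inv Q := Subtype.ext (crossedProduct_ofCrossed hX hπ Q.1 Q.2.1 Q.2.2)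
  map_rel_iff' := IntermediateAlgebra.crossedProduct_le_iff

end Lattice

/-- The correspondence `Z ↦ L^∞(Z)` between intermediate extensions up to equivalence and
intermediate algebras. -/
def extensionEquiv {Γ : Type uΓ} [Group Γ] [Countable Γ] {X : Type uX} [MeasurableSpace X]
    [StandardBorelSpace X] {Y : Type uY} [MeasurableSpace Y] [MeasurableSpace.CountablyGenerated Y]
    {μ : Measure X} {ν : Measure Y} [IsProbabilityMeasure ν]
    [MulAction Γ X] [NonsingularAction Γ μ] [MulAction Γ Y] [NonsingularAction Γ ν] {π : Y → X}
    (hπ : IsFactorMap Γ ν μ π) :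
    ExtensionClass.{uΓ, uX, uY, w} Γ μ ν π ≃ IntermediateAlgebra Γ μ ν π hπ.quasi :=
  Equiv.ofBijective
    (Quotient.lift (IntermediateExtension.toAlgebra hπ.quasi) fun _ _ h =>
      IntermediateAlgebra.ext (Set.Subset.antisymm
        (IntermediateExtension.linfty_subset_of_equivalent (Setoid.symm h))
        (IntermediateExtension.linfty_subset_of_equivalent h))) <| by
    constructor
    · rintro ⟨E⟩ ⟨E'⟩ h
      exact Quotient.sound (IntermediateExtension.equivalent_of_linfty_eq
        (congrArg IntermediateAlgebra.carrier h))
    · intro N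
      obtain ⟨E, hE⟩ := IntermediateExtension.exists_linfty_eq_carrier.{uΓ, uX, uY, w} hπ N
      exact ⟨⟦E⟧, IntermediateAlgebra.ext hE⟩

end CrossedProductLattice

end

theorem theorem3p6_general {Γ : Type uΓ} [Group Γ] [Countable Γ]
    {X : Type uX} [MeasurableSpace X] [StandardBorelSpace X]
    {Y : Type uY} [MeasurableSpace Y] [MeasurableSpace.CountablyGenerated Y]
    (μ : Measure X) (ν : Measure Y) [IsProbabilityMeasure ν]
    [MulAction Γ X] [NonsingularAction Γ μ] [MulAction Γ Y] [NonsingularAction Γ ν]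
    (hX : EssentiallyFree Γ μ)
    (π : Y → X) (hπ : IsFactorMap Γ ν μ π) :
    ∃ (Ψ : ExtensionClass.{uΓ, uX, uY, w} Γ μ ν π ≃ IntermediateAlgebra Γ μ ν π hπ.quasi)
      (Φ : IntermediateAlgebra Γ μ ν π hπ.quasi ≃o
        Set.Icc (crossedProduct Γ (Set.range (pullback π hπ.quasi)))
          (crossedProduct Γ (Set.univ : Set (Lp ℂ ∞ ν)))),
      (∀ E : IntermediateExtension.{uΓ, uX, uY, w} Γ μ ν π,
        (Ψ ⟦E⟧).carrier = E.linfty ∧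
        (Φ (Ψ ⟦E⟧)).1 = crossedProduct Γ E.linfty) ∧
      (∀ N₁ N₂ : IntermediateAlgebra Γ μ ν π hπ.quasi,
        ∃ N : IntermediateAlgebra Γ μ ν π hπ.quasi,
          N.carrier = N₁.carrier ∩ N₂.carrier ∧
          ∀ T, T ∈ (Φ N).1 ↔ T ∈ (Φ N₁).1 ∧ T ∈ (Φ N₂).1) ∧
      (∀ N₁ N₂ : IntermediateAlgebra Γ μ ν π hπ.quasi,
        ∃ N : IntermediateAlgebra Γ μ ν π hπ.quasi,
          mulOp '' N.carrier = generated (mulOp '' N₁.carrier ∪ mulOp '' N₂.carrier) ∧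
          (Φ N).1 = generated ({T | T ∈ (Φ N₁).1} ∪ {T | T ∈ (Φ N₂).1})) :=
  ⟨extensionEquiv hπ, crossedProductOrderIso hX hπ, fun _ => ⟨rfl, rfl⟩,
    fun N₁ N₂ => ⟨N₁.inter N₂, rfl, fun _ => N₁.mem_crossedProduct_inter_iff N₂⟩,
    fun N₁ N₂ => ⟨N₁.join N₂, N₁.image_join N₂, N₁.crossedProduct_join N₂⟩⟩

theorem theorem3p6 {Γ : Type uΓ} [Group Γ] [Countable Γ]
    {X : Type uX} [MeasurableSpace X] [StandardBorelSpace X]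
    {Y : Type uY} [MeasurableSpace Y] [StandardBorelSpace Y]
    (μ : Measure X) [IsProbabilityMeasure μ] (ν : Measure Y) [IsProbabilityMeasure ν]
    [MulAction Γ X] [NonsingularAction Γ μ] [MulAction Γ Y] [NonsingularAction Γ ν]
    (hX : EssentiallyFree Γ μ) (hY : EssentiallyFree Γ ν)
    (π : Y → X) (hπ : IsFactorMap Γ ν μ π) :
    -- `Ψ` identifies (classes of) intermediate extensions `Z` with the algebras `L^∞(Z)`;
    -- `Φ` is the isomorphism `L^∞(Z) ↦ L^∞(Z) ⋊ Γ`.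
    ∃ (Ψ : ExtensionClass.{uΓ, uX, uY, w} Γ μ ν π ≃ IntermediateAlgebra Γ μ ν π hπ.quasi)
      (Φ : IntermediateAlgebra Γ μ ν π hπ.quasi ≃o
        Set.Icc (crossedProduct Γ (Set.range (pullback π hπ.quasi)))
          (crossedProduct Γ (Set.univ : Set (Lp ℂ ∞ ν)))),
      (∀ E : IntermediateExtension.{uΓ, uX, uY, w} Γ μ ν π,
        (Ψ ⟦E⟧).carrier = E.linfty ∧
        (Φ (Ψ ⟦E⟧)).1 = crossedProduct Γ E.linfty) ∧
      -- meets are intersections, on both sides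
      (∀ N₁ N₂ : IntermediateAlgebra Γ μ ν π hπ.quasi,
        ∃ N : IntermediateAlgebra Γ μ ν π hπ.quasi,
          N.carrier = N₁.carrier ∩ N₂.carrier ∧
          ∀ T, T ∈ (Φ N).1 ↔ T ∈ (Φ N₁).1 ∧ T ∈ (Φ N₂).1) ∧
      -- joins are generated von Neumann algebras, on both sides
      (∀ N₁ N₂ : IntermediateAlgebra Γ μ ν π hπ.quasi,
        ∃ N : IntermediateAlgebra Γ μ ν π hπ.quasi,
          mulOp '' N.carrier = generated (mulOp '' N₁.carrier ∪ mulOp '' N₂.carrier) ∧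
          (Φ N).1 = generated ({T | T ∈ (Φ N₁).1} ∪ {T | T ∈ (Φ N₂).1})) :=
  theorem3p6_general μ ν hX π hπ
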